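/- Theorem. Let $Z$ be a set with a pseudometric $d\colon Z\times Z\to[0,\infty]$ (symmetric, $d(z,z)=0$, satisfying the triangle inequality; the value $\infty$ and $d(z,z')=0$ for $z\neq z'$ are allowed), let $X\cup Y=Z$ be a cover, put $A:=X\cap Y$, and let $r\in[0,\infty)$. For $S\subset Z$, let $\mathrm{VR}_r(S)$ be the simplicial complex of all non-empty finite $\sigma\subset S$ with $d(x,y)\le r$ for all $x,y\in\sigma$. Let $$P:=\{\sigma\in \mathrm{VR}_r(Z) : \sigma\subset X\ \text{or}\ \sigma\subset Y\ \text{or}\ \sigma\cap A\neq\emptyset\},$$ and for $\sigma\in\mathrm{VR}_r(Z)$ let $\mathrm{St}(\sigma,A):=\{\mu\subset A : \mu\neq\emptyset \text{ finite},\ \mu\cup\sigma\in \mathrm{VR}_r(Z)\}$, a simplicial complex. Assume that: 1. $A$ is finite; 2. $(Z,d)$ is a metric gluing: $d(x,y)=\inf\{d(x,a)+d(a,y) : a\in A\}$ (infimum in $[0,\infty]$) for all $x\in X\setminus A$ and $y\in Y\setminus A$; 3. (strong simplex assumption at scale $r$) for every $\sigma\in\mathrm{VR}_r(Z)\setminus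 P$ with $|\sigma|=2$, every $v\in\sigma$, and all $a,b\in A$ with $d(a,v)\le r$ and $d(v,b)\le r$, one has $2d(a,b)\le d(a,v)+d(v,b)$. Then, for every simplex $\sigma\in\mathrm{VR}_r(Z)\setminus P$ such that $|\sigma\cap X|=1$ or $|\sigma\cap Y|=1$, the complex $\mathrm{St}(\sigma,A)$ is contractible (that is, its geometric realization with the weak topology is contractible). Moreover all homotopy fibers of the inclusion of geometric realizations $$|\mathrm{VR}_r(X)\cup\mathrm{VR}_r(Y)|\hookrightarrow|\mathrm{VR}_r(Z)|$$ are simply connected (in particular non-empty and path connected), and this map induces a bijection on $\pi_0$ and, for every choice of base point in $|\mathrm{VR}_r(X)\cup\mathrm{VR}_r(Y)|$, an isomorphism on $\pi_1$ and a surjection on $\pi_2$. -/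

import Mathlib

open scoped NNReal ENNReal

noncomputable section

namespace SimplicialGluing

universe u v w

/-! ### Geometric realization of a simplicial complex -/

/-- The geometric realization `|K|` of a simplicial complex `K` with vertices in `V`: the formal
convex combinations of vertices (barycentric coordinates) whose support is a simplex of `K`. It
carries the weak topology, see the instance below. -/
def Realization {V : Type u} (K : PreAbstractSimplicialComplex V) : Type u :=
  {t : V →₀ ℝ // t.support ∈ K ∧ (∀ x, 0 ≤ t x) ∧ (t.sum fun _ a => a) = 1}

open Classical in
/-- Extension by zero of barycentric coordinates on a finite set of vertices. -/
def extendZero {V : Type u} (σ : Finset V) (p : σ → ℝ) : V →₀ ℝ :=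
  Finsupp.onFinset σ (fun x => if h : x ∈ σ then p ⟨x, h⟩ else 0) (by
    intro x hx
    by_contra h
    simp [h] at hx)

theorem extendZero_apply_mem {V : Type u} (σ : Finset V) (p : σ → ℝ) (x : σ) :
    extendZero σ p x = p x := by
  simp [extendZero]

theorem extendZero_apply_notMem {V : Type u} (σ : Finset V) (p : σ → ℝ) {x : V} (hx : x ∉ σ) :
    extendZero σ p x = 0 := by
  simp [extendZero, hx]

theorem support_extendZero_subset {V : Type u} (σ : Finset V) (p : σ → ℝ) :
    (extendZero σ p).support ⊆ σ :=
  Finsupp.support_onFinset_subset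

theorem sum_extendZero {V : Type u} (σ : Finset V) (p : σ → ℝ) :
    ((extendZero σ p).sum fun _ a => a) = ∑ x : σ, p x := by
  rw [Finsupp.sum_of_support_subset _ (support_extendZero_subset σ p) _ (fun _ _ => rfl),
    ← Finset.sum_coe_sort]
  exact Finset.sum_congr rfl fun x _ => extendZero_apply_mem σ p x

/-- The characteristic map of a simplex `σ` of `K`, from the standard (topological) simplex on the
vertices of `σ` to `|K|`. -/
def faceMap {V : Type u} (K : PreAbstractSimplicialComplex V) (σ : Finset V) (hσ : σ ∈ K)
    (p : stdSimplex ℝ σ) : Realization K :=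
  ⟨extendZero σ p.1, by
    have hsum : ((extendZero σ p.1).sum fun _ a => a) = 1 := by
      rw [sum_extendZero]; exact p.2.2
    refine ⟨(K.isRelLowerSet_faces hσ).2 (support_extendZero_subset σ p.1) ?_, ?_, hsum⟩
    · rw [Finset.nonempty_iff_ne_empty]
      intro h
      rw [Finsupp.sum, h, Finset.sum_empty] at hsum
      exact zero_ne_one hsum
    · intro x
      by_cases hx : x ∈ σ
      · rw [extendZero_apply_mem σ p.1 ⟨x, hx⟩]; exact p.2.1 _
      · rw [extendZero_apply_notMem σ p.1 hx]⟩

/-- The weak topology on `|K|`: a subset is open if and only if its preimage in each closed simplex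
is open. -/
instance {V : Type u} (K : PreAbstractSimplicialComplex V) : TopologicalSpace (Realization K) :=
  ⨆ σ : {σ : Finset V // σ ∈ K},
    TopologicalSpace.coinduced (faceMap K σ.1 σ.2) inferInstance

theorem continuous_faceMap {V : Type u} (K : PreAbstractSimplicialComplex V) (σ : Finset V)
    (hσ : σ ∈ K) : Continuous (faceMap K σ hσ) :=
  continuous_iff_coinduced_le.2
    (le_iSup (fun σ : {σ : Finset V // σ ∈ K} =>
      TopologicalSpace.coinduced (faceMap K σ.1 σ.2) inferInstance) ⟨σ, hσ⟩)

theorem continuous_realization_iff {V : Type u} {K : PreAbstractSimplicialComplex V}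
    {T : Type v} [TopologicalSpace T] {f : Realization K → T} :
    Continuous f ↔ ∀ (σ : Finset V) (hσ : σ ∈ K), Continuous (f ∘ faceMap K σ hσ) := by
  constructor
  · intro hf σ hσ
    exact hf.comp (continuous_faceMap K σ hσ)
  · intro h
    exact continuous_iSup_dom.2 fun σ => continuous_coinduced_dom.2 (h σ.1 σ.2)

/-- The inclusion `|L| ⊂ |K|` of the realization of a subcomplex `L ⊂ K`. -/
def realizationInclusion {V : Type u} {L K : PreAbstractSimplicialComplex V} (h : L ≤ K) :
    C(Realization L, Realization K) where
  toFun t := ⟨t.1, h t.2.1, t.2.2⟩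
  continuous_toFun := continuous_realization_iff.2 fun σ hσ => continuous_faceMap K σ (h hσ)

/-! ### Homotopy fibers and maps induced on homotopy groups -/

/-- The homotopy fiber of `f : S → T` over `t`: the pairs of a point `s` of `S` and a path in `T`
from `f s` to `t`, with the subspace topology of the product of `S` and the path space (with the
compact-open topology). -/
def HomotopyFiber {S : Type u} {T : Type v} [TopologicalSpace S] [TopologicalSpace T]
    (f : C(S, T)) (t : T) : Type (max u v) :=
  {p : S × C(unitInterval, T) // p.2 0 = f p.1 ∧ p.2 1 = t}

instance {S : Type u} {T : Type v} [TopologicalSpace S] [TopologicalSpace T]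
    (f : C(S, T)) (t : T) : TopologicalSpace (HomotopyFiber f t) :=
  inferInstanceAs (TopologicalSpace {p : S × C(unitInterval, T) // p.2 0 = f p.1 ∧ p.2 1 = t})

/-- The map induced by `f` on the sets of path components. -/
def piZeroMap {S : Type u} {T : Type v} [TopologicalSpace S] [TopologicalSpace T]
    (f : C(S, T)) : ZerothHomotopy S → ZerothHomotopy T :=
  ZerothHomotopy.lift (fun s => ZerothHomotopy.mk (f s))
    fun _ _ γ => ZerothHomotopy.sound (γ.map f.continuous)

/-- Postcomposition of a generalized loop with a continuous map. -/
def genLoopMap {N : Type w} {S : Type u} {T : Type v} [TopologicalSpace S] [TopologicalSpace T]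
    (f : C(S, T)) {s : S} (p : GenLoop N S s) : GenLoop N T (f s) :=
  ⟨f.comp p.1, fun y hy => congrArg f (p.2 y hy)⟩

/-- The map induced by `f` on the homotopy groups based at `s` and `f s`. -/
def homotopyGroupMap (N : Type w) {S : Type u} {T : Type v} [TopologicalSpace S]
    [TopologicalSpace T] (f : C(S, T)) (s : S) : HomotopyGroup N S s → HomotopyGroup N T (f s) :=
  Quotient.map (genLoopMap f) fun _ _ h => h.map fun H => H.compContinuousMap f

/-! ### Obstruction complexes and push-out decompositions -/

open Classical in
/-- The obstruction complex `St(σ, A) = {μ ⊂ A | 0 < |μ| and μ ∪ σ ∈ K}`. -/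
def obstructionComplex {V : Type u} (K : PreAbstractSimplicialComplex V) (σ : Finset V)
    (A : Set V) : PreAbstractSimplicialComplex V where
  faces := {μ | (μ : Set V) ⊆ A ∧ μ.Nonempty ∧ μ ∪ σ ∈ K}
  isRelLowerSet_faces := by
    rintro μ ⟨hA, hne, hK⟩
    refine ⟨hne, fun ν hν hνne => ⟨?_, hνne, ?_⟩⟩
    · exact (Finset.coe_subset.2 hν).trans hA
    · exact (K.isRelLowerSet_faces hK).2 (Finset.union_subset_union_left hν)
        (hνne.mono Finset.subset_union_left)

/-- The poset `P` of those simplices of `K` that are contained in `X`, or are contained in `Y`, or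
meet `X ∩ Y`. -/
def decompositionPoset {V : Type u} (K : PreAbstractSimplicialComplex V) (X Y : Set V) :
    Set (Finset V) :=
  {σ | σ ∈ K ∧ ((σ : Set V) ⊆ X ∨ (σ : Set V) ⊆ Y ∨ ((σ : Set V) ∩ (X ∩ Y)).Nonempty)}

/-! ### Vietoris-Rips complexes and metric gluings -/

/-- The Vietoris-Rips complex `VR_r(S)` of a subspace `S` of `Z`: the nonempty finite subsets of
`S` of diameter at most `r`. -/
def vietorisRips {Z : Type u} [PseudoEMetricSpace Z] (S : Set Z) (r : ℝ≥0) :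
    PreAbstractSimplicialComplex Z where
  faces := {σ | σ.Nonempty ∧ (σ : Set Z) ⊆ S ∧ ∀ x ∈ σ, ∀ y ∈ σ, edist x y ≤ (r : ℝ≥0∞)}
  isRelLowerSet_faces := by
    rintro σ ⟨hne, hS, hd⟩
    exact ⟨hne, fun τ hτ hτne => ⟨hτne, (Finset.coe_subset.2 hτ).trans hS,
      fun x hx y hy => hd x (hτ hx) y (hτ hy)⟩⟩

theorem vietorisRips_mono {Z : Type u} [PseudoEMetricSpace Z] {S T : Set Z} (h : S ⊆ T)
    (r : ℝ≥0) : vietorisRips S r ≤ vietorisRips T r :=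
  fun _ hσ => ⟨hσ.1, hσ.2.1.trans h, hσ.2.2⟩

/-- The inclusion `|VR_r(X) ∪ VR_r(Y)| ⊂ |VR_r(Z)|`. -/
def ripsInclusion {Z : Type u} [PseudoEMetricSpace Z] (X Y : Set Z) (r : ℝ≥0) :
    C(Realization (vietorisRips X r ⊔ vietorisRips Y r),
      Realization (vietorisRips (Set.univ : Set Z) r)) :=
  realizationInclusion (sup_le (vietorisRips_mono (Set.subset_univ X) r)
    (vietorisRips_mono (Set.subset_univ Y) r))

/-- The pseudometric on `Z` is a metric gluing with respect to the cover by `X` and `Y`: for `x` in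
`X ∖ A` and `y` in `Y ∖ A`, where `A = X ∩ Y`, the distance from `x` to `y` is the infimum in
`[0, ∞]` of `d(x, a) + d(a, y)` over `a` in `A`. -/
def IsMetricGluing {Z : Type u} [PseudoEMetricSpace Z] (X Y : Set Z) : Prop :=
  X ∪ Y = Set.univ ∧
    ∀ x ∈ X \ (X ∩ Y), ∀ y ∈ Y \ (X ∩ Y), edist x y = ⨅ a ∈ X ∩ Y, (edist x a + edist a y)

/-- The strong simplex assumption at scale `r`: for every vertex `v` of an edge `σ` of
`VR_r(Z) ∖ P` and all `a`, `b` in `A = X ∩ Y` with `d(a, v) ≤ r` and `d(v, b) ≤ r`, one has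
`2 d(a, b) ≤ d(a, v) + d(v, b)`. -/
def StrongSimplexAssumption {Z : Type u} [PseudoEMetricSpace Z] (X Y : Set Z) (r : ℝ≥0) : Prop :=
  ∀ σ ∈ vietorisRips (Set.univ : Set Z) r,
    σ ∉ decompositionPoset (vietorisRips (Set.univ : Set Z) r) X Y → σ.card = 2 →
      ∀ v ∈ σ, ∀ a ∈ X ∩ Y, ∀ b ∈ X ∩ Y, edist a v ≤ (r : ℝ≥0∞) → edist v b ≤ (r : ℝ≥0∞) →
        2 * edist a b ≤ edist a v + edist v b

end SimplicialGluing

end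

/-! Call a simplex of VR_r(Z) outside P separated: it avoids A and meets both X and Y. The metric
core is that a separated simplex σ with a single vertex x on one side has a point b ∈ A within r of
all its vertices. Every other vertex y is reached from x through some a(y) ∈ A with d(x,a(y)) +
d(a(y),y) ≤ r, because an infimum over a finite set is attained. Take b = a(y₀) with d(x,a(y₀))
least. The simplex assumption at x gives 2d(b,a(y)) ≤ d(b,x) + d(x,a(y)) ≤ 2d(x,a(y)), hence d(b,y)
≤ r (`exists_close_of_forall_exists`). The same assumption makes any two points of A close to σ
close to each other, so St(σ,A) is a full simplex on a nonempty finite set.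

On the topological side, the square has covering dimension two, so a map from it to |VR_r(Z)| can be
given supports of at most three vertices. A separated simplex with at most three vertices has a lone
vertex on one side, so b exists for it; a two-two split of four vertices is out of reach, which is
why the argument stops in dimension two. Mass is pushed off the separated triangles, and then off
the separated edges, onto b (`exists_transfer`), until the map lands in |VR_r(X) ∪ VR_r(Y)|. Points
already there stay there throughout (`exists_homotopyWith_square`), so the deformation can be made
relative to the boundary (`HasFreeCompression.hasCompression`).

Compressing intervals and squares yields the claims on π₀, π₁ and π₂. For the fibers, a sphere in
the homotopy fiber over t is, up to reparametrization, a map from a ball to |VR_r(Z)| with center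
sent to t; compressing that ball fills the sphere inside the fiber (`exists_fiber_extension`). -/

namespace SimplicialGluing

open Topology

universe u v

/-! ### The weak topology: continuity by coordinates, compact sets, straight-line homotopies. -/

section Topology

variable {V : Type u} {K L : PreAbstractSimplicialComplex V}

theorem Realization.ext {p q : Realization K} (h : ∀ x, p.1 x = q.1 x) : p = q :=
  Subtype.ext (Finsupp.ext h)

theorem continuous_coord (x : V) : Continuous fun p : Realization K => p.1 x := by
  classical
  refine continuous_realization_iff.2 fun σ hσ => ?_
  by_cases hx : x ∈ σ
  · have : (fun p : Realization K => p.1 x) ∘ faceMap K σ hσ = fun p => p.1 ⟨x, hx⟩ :=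
      funext fun p => extendZero_apply_mem σ p.1 ⟨x, hx⟩
    rw [this]
    exact (continuous_apply _).comp continuous_subtype_val
  · have : (fun p : Realization K => p.1 x) ∘ faceMap K σ hσ = fun _ => 0 :=
      funext fun p => extendZero_apply_notMem σ p.1 hx
    rw [this]
    exact continuous_const

/-- A point of `|K|` is in the image of every closed simplex that contains its support. -/
theorem exists_faceMap_eq {σ : Finset V} (hσ : σ ∈ K) (p : Realization K)
    (hp : p.1.support ⊆ σ) : ∃ q, faceMap K σ hσ q = p := by
  refine ⟨⟨fun x => p.1 x, fun x => p.2.2.1 x, ?_⟩, Realization.ext fun x => ?_⟩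
  · rw [Finset.sum_coe_sort σ (fun x => p.1 x)]
    exact (Finsupp.sum_of_support_subset _ hp (fun _ a => a) (fun _ _ => rfl)).symm.trans p.2.2.2
  · by_cases hx : x ∈ σ
    · exact extendZero_apply_mem σ _ ⟨x, hx⟩
    · exact (extendZero_apply_notMem σ _ hx).trans
        (Finsupp.notMem_support_iff.1 fun h => hx (hp h)).symm

theorem support_faceMap_subset {σ : Finset V} (hσ : σ ∈ K) (q) :
    (faceMap K σ hσ q).1.support ⊆ σ :=
  support_extendZero_subset σ q.1

/-- A map into a finite part of `|K|` is continuous if its barycentric coordinates are. -/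
theorem continuous_of_coord {T : Type v} [TopologicalSpace T] {f : T → Realization K}
    (W : Finset V) (hW : ∀ t, (f t).1.support ⊆ W)
    (hc : ∀ x, Continuous fun t => (f t).1 x) : Continuous f := by
  classical
  refine continuous_iff_isClosed.2 fun C hC => ?_
  -- The part of `C` in each closed simplex is compact, hence closed in coordinate space. Only
  -- finitely many simplices lie in `W`, so the preimage of `C` is that of a finite union of closed
  -- sets.
  let E : {σ : Finset V // σ ∈ K} → Set (V → ℝ) := fun σ =>
    (fun p : Realization K => (p.1 : V → ℝ)) '' (faceMap K σ.1 σ.2 '' (faceMap K σ.1 σ.2 ⁻¹' C))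
  have hE : ∀ σ, IsClosed (E σ) := fun σ => by
    have h1 : IsCompact (faceMap K σ.1 σ.2 ⁻¹' C) :=
      (hC.preimage (continuous_faceMap K σ.1 σ.2)).isCompact
    exact ((h1.image (continuous_faceMap K σ.1 σ.2)).image
      (continuous_pi fun x => continuous_coord x)).isClosed
  have hfin : {σ : {σ : Finset V // σ ∈ K} | σ.1 ⊆ W}.Finite :=
    Set.Finite.preimage Subtype.val_injective.injOn
      (s := {σ : Finset V | σ ⊆ W}) ((W.powerset.finite_toSet).subset fun σ hσ => by simpa using hσ)
  have key : f ⁻¹' C = (fun t => ((f t).1 : V → ℝ)) ⁻¹'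
      ⋃ σ ∈ {σ : {σ : Finset V // σ ∈ K} | σ.1 ⊆ W}, E σ := by
    ext t
    simp only [Set.mem_preimage, Set.mem_iUnion, exists_prop]
    constructor
    · intro ht
      obtain ⟨q, hq⟩ := exists_faceMap_eq (f t).2.1 (f t) subset_rfl
      exact ⟨⟨_, (f t).2.1⟩, hW t, f t, ⟨q, by rwa [Set.mem_preimage, hq], hq⟩, rfl⟩
    · rintro ⟨σ, -, p, ⟨q, hq, rfl⟩, hp⟩
      have : faceMap K σ.1 σ.2 q = f t := Realization.ext fun x => congrFun hp x
      rwa [← this]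
  rw [key]
  exact (hfin.isClosed_biUnion fun σ _ => hE σ).preimage (continuous_pi hc)

/-- A compact subset of `|K|` has only finitely many vertices. -/
theorem exists_finset_support_subset {C : Set (Realization K)} (hC : IsCompact C) :
    ∃ W : Finset V, ∀ p ∈ C, p.1.support ⊆ W := by
  classical
  let U : Set V := {x | ∃ p ∈ C, x ∈ p.1.support}
  suffices hU : U.Finite from
    ⟨hU.toFinset, fun p hp x hx => hU.mem_toFinset.2 ⟨p, hp, hx⟩⟩
  rcases U.eq_empty_or_nonempty with hU | ⟨_, p₀, -⟩
  · exact hU ▸ Set.finite_empty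
  have : Nonempty (Realization K) := ⟨p₀⟩
  choose! g hgC hg using fun (x : V) (hx : x ∈ U) => hx
  -- A closed simplex `σ` contains `g x` only if `x ∈ σ`, so it meets `g '' U` in a finite set. Thus
  -- every subset of `g '' U` is closed, and `g '' U` is compact and discrete, hence finite.
  have hclosed : ∀ S ⊆ g '' U, IsClosed S := by
    intro S hS
    have hpre : ∀ σ : {σ : Finset V // σ ∈ K}, IsClosed (faceMap K σ.1 σ.2 ⁻¹' S) := by
      intro σ
      have hfin : (S ∩ Set.range (faceMap K σ.1 σ.2)).Finite := by
        refine (σ.1.finite_toSet.image g).subset ?_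
        rintro p ⟨hpS, q, rfl⟩
        obtain ⟨x, hx, hxp⟩ := hS hpS
        refine ⟨x, support_faceMap_subset σ.2 q ?_, hxp⟩
        rw [← hxp]
        exact hg x hx
      have hcl : IsClosed ((fun p : Realization K => (p.1 : V → ℝ)) ''
          (S ∩ Set.range (faceMap K σ.1 σ.2))) := (hfin.image _).isClosed
      have := hcl.preimage ((continuous_pi fun x => continuous_coord x).comp
        (continuous_faceMap K σ.1 σ.2))
      convert this using 1
      ext q
      constructor
      · exact fun hq => ⟨_, ⟨hq, q, rfl⟩, rfl⟩
      · rintro ⟨p, ⟨hp, -⟩, hpq⟩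
        have : p = faceMap K σ.1 σ.2 q := Realization.ext fun x => congrFun hpq x
        rwa [Set.mem_preimage, ← this]
    refine isClosed_iSup_iff.2 fun σ => isClosed_coinduced.2 (hpre σ)
  have hsub : g '' U ⊆ C := by
    rintro _ ⟨x, hx, rfl⟩
    exact hgC x hx
  have hcomp : IsCompact (g '' U) := hC.of_isClosed_subset (hclosed _ subset_rfl) hsub
  have hdisc : IsDiscrete (g '' U) := by
    refine ⟨discreteTopology_iff_isOpen_singleton.2 fun p => ?_⟩
    rw [← isClosed_compl_iff]
    have h := (hclosed ((g '' U) \ {p.1}) Set.sdiff_subset).preimage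
      (continuous_subtype_val (p := (· ∈ g '' U)))
    convert h using 1
    ext q
    simp [Subtype.ext_iff]
  have hfin : (g '' U).Finite := hcomp.finite hdisc
  refine (hfin.biUnion fun p _ => p.1.support.finite_toSet).subset fun x hx => ?_
  exact Set.mem_biUnion (Set.mem_image_of_mem g hx) (hg x hx)

theorem exists_finset_support_subset_of_compactSpace {T : Type v} [TopologicalSpace T]
    [CompactSpace T] {f : T → Realization K} (hf : Continuous f) :
    ∃ W : Finset V, ∀ t, (f t).1.support ⊆ W :=
  (exists_finset_support_subset (isCompact_range hf)).imp fun _ h t => h _ ⟨t, rfl⟩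

/-- A map from a compact space to `|L|` is continuous if its composition with the inclusion into
`|K|` is. -/
theorem continuous_of_continuous_inclusion {T : Type v} [TopologicalSpace T] [CompactSpace T]
    (h : L ≤ K) {f : T → Realization L} (hf : Continuous fun t => realizationInclusion h (f t)) :
    Continuous f := by
  obtain ⟨W, hW⟩ := exists_finset_support_subset_of_compactSpace hf
  exact continuous_of_coord W hW fun x => ((continuous_coord x).comp hf :)

theorem realizationInclusion_injective (h : L ≤ K) :
    Function.Injective (realizationInclusion h) := fun _ _ hpq =>
  Subtype.ext (congrArg (fun p : Realization K => p.1) hpq)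

theorem Realization.sum_eq_one (p : Realization K) {W : Finset V} (hW : p.1.support ⊆ W) :
    ∑ x ∈ W, p.1 x = 1 :=
  (Finsupp.sum_of_support_subset _ hW (fun _ a => a) (fun _ _ => rfl)).symm.trans p.2.2.2

/-- Construction of a point of `|K|` from barycentric coordinates. -/
theorem mem_realization_of {t : V →₀ ℝ} {W ρ : Finset V} (hW : t.support ⊆ W) (hρ : ρ ∈ K)
    (htρ : t.support ⊆ ρ) (h0 : ∀ x, 0 ≤ t x) (h1 : ∑ x ∈ W, t x = 1) :
    t.support ∈ K ∧ (∀ x, 0 ≤ t x) ∧ (t.sum fun _ a => a) = 1 := by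
  have hsum : (t.sum fun _ a => a) = 1 :=
    (Finsupp.sum_of_support_subset _ hW (fun _ a => a) (fun _ _ => rfl)).trans h1
  refine ⟨(K.isRelLowerSet_faces hρ).2 htρ (Finset.nonempty_iff_ne_empty.2 fun h => ?_), h0, hsum⟩
  rw [Finsupp.sum, h, Finset.sum_empty] at hsum
  exact zero_ne_one hsum

/-- Two continuous maps into a finite part of `|K|`, such that the two images of each point lie in a
common simplex, are homotopic by straight lines. -/
theorem exists_straightLine {T : Type v} [TopologicalSpace T] {f₀ f₁ : T → Realization K}
    (hf₀ : Continuous f₀) (hf₁ : Continuous f₁) (W : Finset V)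
    (hW₀ : ∀ t, (f₀ t).1.support ⊆ W) (hW₁ : ∀ t, (f₁ t).1.support ⊆ W)
    (hc : ∀ t, ∃ ρ ∈ K, (f₀ t).1.support ⊆ ρ ∧ (f₁ t).1.support ⊆ ρ) :
    ∃ H : C(unitInterval × T, Realization K), ∀ s t,
      (H (s, t)).1 = (1 - (s : ℝ)) • (f₀ t).1 + (s : ℝ) • (f₁ t).1 := by
  classical
  have hsupp : ∀ (s : unitInterval) t (ρ : Finset V), (f₀ t).1.support ⊆ ρ → (f₁ t).1.support ⊆ ρ →
      ((1 - (s : ℝ)) • (f₀ t).1 + (s : ℝ) • (f₁ t).1).support ⊆ ρ := fun s t ρ h0 h1 =>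
    Finsupp.support_add.trans (Finset.union_subset (Finsupp.support_smul.trans h0)
      (Finsupp.support_smul.trans h1))
  have hmem : ∀ (s : unitInterval) t,
      ((1 - (s : ℝ)) • (f₀ t).1 + (s : ℝ) • (f₁ t).1).support ∈ K ∧
      (∀ x, 0 ≤ ((1 - (s : ℝ)) • (f₀ t).1 + (s : ℝ) • (f₁ t).1) x) ∧
      (((1 - (s : ℝ)) • (f₀ t).1 + (s : ℝ) • (f₁ t).1).sum fun _ a => a) = 1 := fun s t => by
    obtain ⟨ρ, hρ, h0, h1⟩ := hc t
    refine mem_realization_of (hsupp s t W (hW₀ t) (hW₁ t)) hρ (hsupp s t ρ h0 h1) (fun x => ?_) ?_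
    · simp only [Finsupp.coe_add, Finsupp.coe_smul, Pi.add_apply, Pi.smul_apply, smul_eq_mul]
      have := (f₀ t).2.2.1 x
      have := (f₁ t).2.2.1 x
      have := s.2.1
      have : 0 ≤ 1 - (s : ℝ) := sub_nonneg.2 s.2.2
      positivity
    · simp only [Finsupp.coe_add, Finsupp.coe_smul, Pi.add_apply, Pi.smul_apply, smul_eq_mul]
      rw [Finset.sum_add_distrib, ← Finset.mul_sum, ← Finset.mul_sum,
        (f₀ t).sum_eq_one (hW₀ t), (f₁ t).sum_eq_one (hW₁ t)]
      ring
  refine ⟨⟨fun z => ⟨_, hmem z.1 z.2⟩, ?_⟩, fun s t => rfl⟩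
  refine continuous_of_coord W (fun z => hsupp z.1 z.2 W (hW₀ _) (hW₁ _)) fun x => ?_
  have h0 : Continuous fun t => (f₀ t).1 x := (continuous_coord x).comp hf₀
  have h1 : Continuous fun t => (f₁ t).1 x := (continuous_coord x).comp hf₁
  simp only [Finsupp.coe_add, Finsupp.coe_smul, Pi.add_apply, Pi.smul_apply, smul_eq_mul]
  have hs : Continuous fun z : unitInterval × T => (z.1 : ℝ) :=
    continuous_subtype_val.comp continuous_fst
  exact ((continuous_const.sub hs).mul (h0.comp continuous_snd)).add
    (hs.mul (h1.comp continuous_snd))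

end Topology

/-! ### Covering dimension of the square, by a triangulated grid. -/

section Square

/-- The closed unit ball of the plane with the supremum norm. -/
abbrev Square : Type := Metric.closedBall (0 : ℝ × ℝ) 1

/-- The piecewise linear hat function at a lattice point of the triangulation of the plane by the
lines `x ∈ ℤ`, `y ∈ ℤ` and `x - y ∈ ℤ`. -/
noncomputable def hat (i : ℤ × ℤ) (x y : ℝ) : ℝ :=
  max 0 (1 - max (max |x - i.1| |y - i.2|) |(x - i.1) - (y - i.2)|)

theorem hat_nonneg (i : ℤ × ℤ) (x y : ℝ) : 0 ≤ hat i x y := le_max_left _ _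

theorem hat_ne_zero_iff {i : ℤ × ℤ} {x y : ℝ} :
    hat i x y ≠ 0 ↔ |x - i.1| < 1 ∧ |y - i.2| < 1 ∧ |(x - i.1) - (y - i.2)| < 1 := by
  have : hat i x y ≠ 0 ↔ 0 < hat i x y :=
    ⟨fun h => lt_of_le_of_ne (hat_nonneg i x y) h.symm, fun h => h.ne'⟩
  rw [this, hat, lt_max_iff]
  simp only [lt_irrefl, false_or, sub_pos, max_lt_iff, and_assoc]

theorem hat_floor_ne_zero (x y : ℝ) : hat (⌊x⌋, ⌊y⌋) x y ≠ 0 := by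
  have hx := Int.fract_nonneg x
  have hx' := Int.fract_lt_one x
  have hy := Int.fract_nonneg y
  have hy' := Int.fract_lt_one y
  simp only [hat_ne_zero_iff, Int.self_sub_floor, abs_lt]
  refine ⟨⟨?_, ?_⟩, ⟨?_, ?_⟩, ?_, ?_⟩ <;> linarith

/-- Only the four corners of the unit cell of `(x, y)` can contribute. The condition on the
difference of the coordinates excludes the corner across the diagonal; which one depends on the
order of the fractional parts. -/
theorem card_hat_ne_zero_le (J : Finset (ℤ × ℤ)) (x y : ℝ) [DecidablePred fun i => hat i x y ≠ 0] :
    (J.filter fun i => hat i x y ≠ 0).card ≤ 3 := by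
  have key : ∀ (t : ℝ) (i : ℤ), |t - i| < 1 → i = ⌊t⌋ ∨ i = ⌊t⌋ + 1 := by
    intro t i hi
    rw [abs_lt] at hi
    have h1 := Int.floor_le t
    have h2 := Int.lt_floor_add_one t
    have h3 : (i : ℝ) < ((⌊t⌋ + 2 : ℤ) : ℝ) := by push_cast; linarith
    have h4 : ((⌊t⌋ - 1 : ℤ) : ℝ) < i := by push_cast; linarith
    have h3' := Int.cast_lt.1 h3
    have h4' := Int.cast_lt.1 h4
    omega
  by_cases h : Int.fract y ≤ Int.fract x
  · refine (Finset.card_le_card (t := {(⌊x⌋, ⌊y⌋), (⌊x⌋ + 1, ⌊y⌋), (⌊x⌋ + 1, ⌊y⌋ + 1)})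
      fun i hi => ?_).trans Finset.card_le_three
    obtain ⟨h1, h2, h3⟩ := hat_ne_zero_iff.1 (Finset.mem_filter.1 hi).2
    obtain ⟨i1, i2⟩ := i
    simp only [Finset.mem_insert, Finset.mem_singleton, Prod.mk.injEq]
    rcases key x i1 h1 with rfl | rfl <;> rcases key y i2 h2 with rfl | rfl <;> simp
    rw [abs_lt] at h3
    simp only [Int.cast_add, Int.cast_one] at h3
    have e1 := Int.self_sub_floor x
    have e2 := Int.self_sub_floor y
    linarith [h3.2]
  · refine (Finset.card_le_card (t := {(⌊x⌋, ⌊y⌋), (⌊x⌋, ⌊y⌋ + 1), (⌊x⌋ + 1, ⌊y⌋ + 1)})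
      fun i hi => ?_).trans Finset.card_le_three
    obtain ⟨h1, h2, h3⟩ := hat_ne_zero_iff.1 (Finset.mem_filter.1 hi).2
    obtain ⟨i1, i2⟩ := i
    simp only [Finset.mem_insert, Finset.mem_singleton, Prod.mk.injEq]
    rcases key x i1 h1 with rfl | rfl <;> rcases key y i2 h2 with rfl | rfl <;> simp
    rw [abs_lt] at h3
    simp only [Int.cast_add, Int.cast_one] at h3
    have e1 := Int.self_sub_floor x
    have e2 := Int.self_sub_floor y
    push Not at h
    linarith [h3.1]

theorem continuous_hat (i : ℤ × ℤ) (n : ℝ) :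
    Continuous fun z : Square => hat i (n * z.1.1) (n * z.1.2) := by
  unfold hat
  fun_prop

/-- The square has covering dimension at most two: every finite open cover, given by continuous
functions, has a subordinate partition of unity with at most three nonzero functions at each
point. -/
theorem exists_partition_card_le_three {V : Type u} (W : Finset V) (f : V → Square → ℝ)
    (hf : ∀ v, Continuous (f v)) (hW : ∀ z, ∃ v ∈ W, 0 < f v z) :
    ∃ g : V → Square → ℝ, (∀ v, Continuous (g v)) ∧ (∀ v z, 0 ≤ g v z) ∧
      (∀ z, ∑ v ∈ W, g v z = 1) ∧ (∀ v z, g v z ≠ 0 → 0 < f v z) ∧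
      ∀ z, ∃ ρ : Finset V, ρ.card ≤ 3 ∧ ∀ v, g v z ≠ 0 → v ∈ ρ := by
  classical
  obtain ⟨δ, hδ, hball⟩ := lebesgue_number_lemma_of_metric (s := Set.univ)
    (c := fun v : W => {z | 0 < f v z}) isCompact_univ
    (fun v => isOpen_lt continuous_const (hf v)) fun z _ => by
      obtain ⟨v, hv, hz⟩ := hW z
      exact Set.mem_iUnion.2 ⟨⟨v, hv⟩, hz⟩
  -- After scaling by `n`, two points in the support of one hat are within 1 of the same lattice
  -- point in each coordinate, so before scaling they are less than `2 / n < δ` apart.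
  obtain ⟨n, hn⟩ := exists_nat_gt (2 / δ)
  have hn0 : (0 : ℝ) < n := lt_of_le_of_lt (by positivity) hn
  let h : ℤ × ℤ → Square → ℝ := fun i z => hat i (n * z.1.1) (n * z.1.2)
  have hcont : ∀ i, Continuous (h i) := fun i => continuous_hat i n
  have hchoice : ∀ i, ∃ v ∈ W, ∀ z, h i z ≠ 0 → 0 < f v z := by
    intro i
    by_cases hi : ∃ z, h i z ≠ 0
    · obtain ⟨z₀, hz₀⟩ := hi
      obtain ⟨v, hv⟩ := hball z₀ trivial
      refine ⟨v, v.2, fun z hz => hv (?_ : dist z z₀ < δ)⟩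
      obtain ⟨a1, a2, -⟩ := hat_ne_zero_iff.1 hz
      obtain ⟨b1, b2, -⟩ := hat_ne_zero_iff.1 hz₀
      have hd : 2 < n * δ := by rwa [div_lt_iff₀ hδ] at hn
      have aux : ∀ s t c : ℝ, |n * s - c| < 1 → |n * t - c| < 1 → |s - t| < δ := by
        intro s t c h1 h2
        rw [abs_lt] at *
        constructor <;> nlinarith
      rw [Subtype.dist_eq, Prod.dist_eq, max_lt_iff, Real.dist_eq, Real.dist_eq]
      exact ⟨aux _ _ _ a1 b1, aux _ _ _ a2 b2⟩
    · push Not at hi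
      obtain ⟨v, hv, -⟩ := hW ⟨0, by simp⟩
      exact ⟨v, hv, fun z hz => absurd (hi z) hz⟩
  choose c hcW hc using hchoice
  let J : Finset (ℤ × ℤ) := Finset.Icc (-n : ℤ) n ×ˢ Finset.Icc (-n : ℤ) n
  -- Dividing by the total requires only its positivity, which comes from the hat at the integer
  -- parts of the scaled coordinates.
  let tot : Square → ℝ := fun z => ∑ i ∈ J, h i z
  have htot : ∀ z, 0 < tot z := by
    intro z
    have hz : ‖z.1‖ ≤ 1 := mem_closedBall_zero_iff.1 z.2
    rw [Prod.norm_def, max_le_iff, Real.norm_eq_abs, Real.norm_eq_abs, abs_le, abs_le] at hz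
    refine Finset.sum_pos' (fun i _ => hat_nonneg _ _ _)
      ⟨(⌊n * z.1.1⌋, ⌊n * z.1.2⌋), ?_, lt_of_le_of_ne (hat_nonneg _ _ _)
        (hat_floor_ne_zero _ _).symm⟩
    have aux : ∀ t : ℝ, -1 ≤ t ∧ t ≤ 1 → ⌊n * t⌋ ∈ Finset.Icc (-n : ℤ) n := by
      intro t ht
      rw [Finset.mem_Icc, Int.le_floor, ← Int.cast_le (R := ℝ)]
      refine ⟨?_, (Int.floor_le _).trans ?_⟩ <;> push_cast <;> nlinarith
    exact Finset.mem_product.2 ⟨aux _ hz.1, aux _ hz.2⟩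
  have hg : ∀ v z, (∑ i ∈ J with c i = v, h i z) / tot z ≠ 0 → ∃ i ∈ J, c i = v ∧ h i z ≠ 0 := by
    intro v z hvz
    obtain ⟨i, hi, hi0⟩ := Finset.exists_ne_zero_of_sum_ne_zero (div_ne_zero_iff.1 hvz).1
    exact ⟨i, (Finset.mem_filter.1 hi).1, (Finset.mem_filter.1 hi).2, hi0⟩
  refine ⟨fun v z => (∑ i ∈ J with c i = v, h i z) / tot z, fun v => ?_, fun v z => ?_,
    fun z => ?_, fun v z hvz => ?_, fun z => ?_⟩
  · exact (continuous_finsetSum _ fun i _ => hcont i).div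
      (continuous_finsetSum _ fun i _ => hcont i) fun z => (htot z).ne'
  · exact div_nonneg (Finset.sum_nonneg fun i _ => hat_nonneg _ _ _) (htot z).le
  · rw [← Finset.sum_div, Finset.sum_fiberwise_of_maps_to (fun i _ => hcW i), div_self (htot z).ne']
  · obtain ⟨i, -, rfl, hi⟩ := hg v z hvz
    exact hc i z hi
  · refine ⟨(J.filter fun i => h i z ≠ 0).image c,
      Finset.card_image_le.trans (card_hat_ne_zero_le J _ _), fun v hvz => ?_⟩
    obtain ⟨i, hiJ, rfl, hi⟩ := hg v z hvz
    exact Finset.mem_image_of_mem c (Finset.mem_filter.2 ⟨hiJ, hi⟩)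

end Square

/-! ### Reduction to the 2-skeleton, and moving mass off simplices. -/

section Transfer

variable {V : Type u} {K L : PreAbstractSimplicialComplex V}

/-- A map from the square to `|K|` can be compressed, within the supports of its values, into the
two-dimensional skeleton. -/
theorem exists_approximation_card_le_three {φ : Square → Realization K} (hφ : Continuous φ) :
    ∃ ψ : Square → Realization K, Continuous ψ ∧ (∀ z, (ψ z).1.support ⊆ (φ z).1.support) ∧
      ∀ z, (ψ z).1.support.card ≤ 3 := by
  classical
  obtain ⟨W, hW⟩ := exists_finset_support_subset_of_compactSpace hφ
  obtain ⟨g, hg, hg0, hg1, hgφ, hg3⟩ := exists_partition_card_le_three W (fun v z => (φ z).1 v)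
    (fun v => (continuous_coord v).comp hφ) fun z => by
      obtain ⟨v, hv⟩ := ((K.isRelLowerSet_faces (φ z).2.1).1 : (φ z).1.support.Nonempty)
      exact ⟨v, hW z hv, lt_of_le_of_ne ((φ z).2.2.1 v) (Finsupp.mem_support_iff.1 hv).symm⟩
  have hsub : ∀ v z, g v z ≠ 0 → v ∈ (φ z).1.support := fun v z h =>
    Finsupp.mem_support_iff.2 (hgφ v z h).ne'
  let t : Square → V →₀ ℝ := fun z =>
    Finsupp.onFinset W (fun v => g v z) fun v h => hW z (hsub v z h)
  have ht : ∀ z, (t z).support ⊆ (φ z).1.support := fun z v hv =>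
    hsub v z (Finsupp.mem_support_iff.1 hv)
  have htW : ∀ z, (t z).support ⊆ W := fun z => (ht z).trans (hW z)
  refine ⟨fun z => ⟨t z, mem_realization_of (htW z) (φ z).2.1 (ht z) (fun v => hg0 v z) (hg1 z)⟩,
    continuous_of_coord W htW fun v => hg v, ht, fun z => ?_⟩
  obtain ⟨ρ, hρ, h⟩ := hg3 z
  exact (Finset.card_le_card fun v hv => h v (Finsupp.mem_support_iff.1 hv)).trans hρ

/-- The minimal coordinate of a point on the vertices in a finite set. -/
noncomputable def minCoord (σ : Finset V) (p : V → ℝ) : ℝ :=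
  open Classical in if h : σ.Nonempty then σ.inf' h p else 0

theorem minCoord_le {σ : Finset V} {x : V} (hx : x ∈ σ) (p : V → ℝ) : minCoord σ p ≤ p x := by
  rw [minCoord, dif_pos ⟨x, hx⟩]
  exact Finset.inf'_le p hx

theorem minCoord_nonneg (σ : Finset V) {p : V → ℝ} (hp : ∀ x, 0 ≤ p x) : 0 ≤ minCoord σ p := by
  rw [minCoord]
  split_ifs with h
  · exact Finset.le_inf' h p fun x _ => hp x
  · exact le_rfl

theorem exists_minCoord_eq {σ : Finset V} (h : σ.Nonempty) (p : V → ℝ) :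
    ∃ x ∈ σ, minCoord σ p = p x := by
  rw [minCoord, dif_pos h]
  exact Finset.exists_mem_eq_inf' h p

/-- This is what makes transfers continuous: the transfer off `σ` fades out by itself as the point
leaves the open star of `σ`. -/
theorem minCoord_eq_zero {σ : Finset V} {p : V →₀ ℝ} (hp : ∀ x, 0 ≤ p x)
    (h : ¬ σ ⊆ p.support) : minCoord σ p = 0 := by
  obtain ⟨x, hx, hxp⟩ := Finset.not_subset.1 h
  exact le_antisymm ((minCoord_le hx p).trans (Finsupp.notMem_support_iff.1 hxp).le)
    (minCoord_nonneg σ hp)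

theorem continuous_minCoord {T : Type v} [TopologicalSpace T] (σ : Finset V) {f : T → V → ℝ}
    (hf : ∀ x, Continuous fun t => f t x) : Continuous fun t => minCoord σ (f t) := by
  by_cases h : σ.Nonempty
  · simp only [minCoord, dif_pos h]
    exact Continuous.finset_inf'_apply h fun x _ => hf x
  · simp only [minCoord, dif_neg h]
    exact continuous_const

open Classical in
/-- The mass that has to be added to `p` to transfer the same amount from all the vertices of `σ` to
the vertex `v`, where the amount is the largest possible one. -/
noncomputable def transferMass (σ : Finset V) (v : V) (p : V → ℝ) (x : V) : ℝ :=
  minCoord σ p * ((if x = v then (σ.card : ℝ) else 0) - if x ∈ σ then 1 else 0)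

theorem sum_transferMass {W σ : Finset V} {v : V} (hσ : σ ⊆ W) (hv : v ∈ W) (p : V → ℝ) :
    ∑ x ∈ W, transferMass σ v p x = 0 := by
  classical
  simp only [transferMass]
  rw [← Finset.mul_sum, Finset.sum_sub_distrib, Finset.sum_ite_eq' W v, if_pos hv,
    Finset.sum_ite_mem, Finset.inter_eq_right.2 hσ]
  simp

/-- For a family `S` of simplices such that the support of each `φ t` contains at most one of them,
transfer as much mass as possible from the vertices of `σ ∈ S` to `b σ`. -/
theorem exists_transfer {T : Type v} [TopologicalSpace T] {φ : T → Realization K}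
    (hφ : Continuous φ) {W : Finset V} (hW : ∀ t, (φ t).1.support ⊆ W) [DecidableEq V]
    (S : Set (Finset V)) (b : Finset V → V) (hne : ∀ σ ∈ S, σ.Nonempty) (hb : ∀ σ ∈ S, b σ ∉ σ)
    (huniq : ∀ t, ∀ σ ∈ S, ∀ τ ∈ S, σ ⊆ (φ t).1.support → τ ⊆ (φ t).1.support → σ = τ)
    (hK : ∀ t, ∀ σ ∈ S, σ ⊆ (φ t).1.support → insert (b σ) (φ t).1.support ∈ K) :
    ∃ (ψ : T → Realization K) (W' : Finset V), Continuous ψ ∧ (∀ t, (ψ t).1.support ⊆ W') ∧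
      (∀ t, (∀ σ ∈ S, ¬ σ ⊆ (φ t).1.support) → ψ t = φ t) ∧
      ∀ t, ∀ σ ∈ S, σ ⊆ (φ t).1.support →
        ∃ x ∈ σ, (ψ t).1.support ⊆ insert (b σ) ((φ t).1.support.erase x) := by
  classical
  let S' : Finset (Finset V) := W.powerset.filter (· ∈ S)
  let W' : Finset V := W ∪ S'.image b
  have hmem : ∀ {t σ}, σ ∈ S → σ ⊆ (φ t).1.support → σ ∈ S' := fun hσ h =>
    Finset.mem_filter.2 ⟨Finset.mem_powerset.2 (h.trans (hW _)), hσ⟩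
  -- One globally continuous formula; by `huniq` at most one summand is active at each `t`.
  let g : T → V → ℝ := fun t x => (φ t).1 x + ∑ σ ∈ S', transferMass σ (b σ) (φ t).1 x
  have hnone : ∀ t, (∀ σ ∈ S, ¬ σ ⊆ (φ t).1.support) → ∀ x, g t x = (φ t).1 x := by
    intro t ht x
    refine (congrArg _ (Finset.sum_eq_zero fun σ hσ => ?_)).trans (add_zero _)
    rw [transferMass, minCoord_eq_zero (φ t).2.2.1 (ht σ (Finset.mem_filter.1 hσ).2), zero_mul]
  have hone : ∀ t, ∀ σ ∈ S, σ ⊆ (φ t).1.support → ∀ x,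
      g t x = (φ t).1 x + transferMass σ (b σ) (φ t).1 x := by
    intro t σ hσ hσt x
    refine congrArg _ (Finset.sum_eq_single_of_mem σ (hmem hσ hσt) fun τ hτ hne' => ?_)
    have hτS := (Finset.mem_filter.1 hτ).2
    rw [transferMass, minCoord_eq_zero (φ t).2.2.1 fun h => hne' (huniq t τ hτS σ hσ h hσt),
      zero_mul]
  have hsupp : ∀ t, ∀ σ ∈ S, σ ⊆ (φ t).1.support →
      ∃ x ∈ σ, ∀ y, g t y ≠ 0 → y ∈ insert (b σ) ((φ t).1.support.erase x) := by
    intro t σ hσ hσt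
    -- A vertex with the least coordinate loses all of its mass, so it drops out of the support.
    obtain ⟨x, hx, hxm⟩ := exists_minCoord_eq (hne σ hσ) (φ t).1
    refine ⟨x, hx, fun y hy => ?_⟩
    by_contra hcon
    simp only [Finset.mem_insert, Finset.mem_erase, not_or, not_and] at hcon
    refine hy ?_
    rw [hone t σ hσ hσt y, transferMass, if_neg hcon.1]
    by_cases hyx : y = x
    · rw [hyx, if_pos hx, hxm]
      ring
    · have hyt := hcon.2 hyx
      rw [if_neg fun h => hyt (hσt h), Finsupp.notMem_support_iff.1 hyt]
      ring
  have hgW : ∀ t x, g t x ≠ 0 → x ∈ W' := by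
    intro t x hx
    by_cases h : ∀ σ ∈ S, ¬ σ ⊆ (φ t).1.support
    · rw [hnone t h x] at hx
      exact Finset.mem_union_left _ (hW t (Finsupp.mem_support_iff.2 hx))
    · push Not at h
      obtain ⟨σ, hσ, hσt⟩ := h
      obtain ⟨y, -, hy⟩ := hsupp t σ hσ hσt
      rcases Finset.mem_insert.1 (hy x hx) with rfl | hx'
      · exact Finset.mem_union_right _ (Finset.mem_image_of_mem b (hmem hσ hσt))
      · exact Finset.mem_union_left _ (hW t (Finset.mem_of_mem_erase hx'))
  have hg0 : ∀ t x, 0 ≤ g t x := by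
    intro t x
    by_cases h : ∀ σ ∈ S, ¬ σ ⊆ (φ t).1.support
    · rw [hnone t h x]
      exact (φ t).2.2.1 x
    · push Not at h
      obtain ⟨σ, hσ, hσt⟩ := h
      rw [hone t σ hσ hσt, transferMass]
      have h0 := minCoord_nonneg σ (φ t).2.2.1
      have h1 := (φ t).2.2.1 x
      by_cases hx : x ∈ σ
      · rw [if_neg fun h : x = b σ => hb σ hσ (h ▸ hx), if_pos hx]
        linarith [minCoord_le hx (φ t).1]
      · rw [if_neg hx, sub_zero]
        split_ifs <;> positivity
  have hg1 : ∀ t, ∑ x ∈ W', g t x = 1 := by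
    intro t
    rw [Finset.sum_add_distrib, (φ t).sum_eq_one ((hW t).trans Finset.subset_union_left),
      Finset.sum_comm, Finset.sum_eq_zero fun σ hσ => ?_, add_zero]
    exact sum_transferMass ((Finset.mem_powerset.1 (Finset.mem_filter.1 hσ).1).trans
      Finset.subset_union_left) (Finset.mem_union_right _ (Finset.mem_image_of_mem b hσ)) _
  let q : T → V →₀ ℝ := fun t => Finsupp.onFinset W' (g t) (hgW t)
  have hqW : ∀ t, (q t).support ⊆ W' := fun t => Finsupp.support_onFinset_subset
  have hq : ∀ t, ∃ ρ ∈ K, (q t).support ⊆ ρ := by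
    intro t
    by_cases h : ∀ σ ∈ S, ¬ σ ⊆ (φ t).1.support
    · refine ⟨_, (φ t).2.1, fun x hx => ?_⟩
      rw [Finsupp.mem_support_iff] at hx ⊢
      rwa [← hnone t h x]
    · push Not at h
      obtain ⟨σ, hσ, hσt⟩ := h
      obtain ⟨y, -, hy⟩ := hsupp t σ hσ hσt
      exact ⟨_, hK t σ hσ hσt, fun x hx =>
        Finset.insert_subset_insert _ (Finset.erase_subset _ _)
          (hy x (Finsupp.mem_support_iff.1 hx))⟩
  have hqK : ∀ t, (q t).support ∈ K ∧ (∀ x, 0 ≤ q t x) ∧ ((q t).sum fun _ a => a) = 1 := by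
    intro t
    obtain ⟨ρ, hρ, h⟩ := hq t
    exact mem_realization_of (hqW t) hρ h (hg0 t) (hg1 t)
  have hcoord : ∀ x, Continuous fun t => (φ t).1 x := fun x => (continuous_coord x).comp hφ
  refine ⟨fun t => ⟨q t, hqK t⟩, W', continuous_of_coord W' hqW fun x => ?_, hqW,
    fun t ht => Realization.ext (hnone t ht), fun t σ hσ hσt => ?_⟩
  · exact (hcoord x).add (continuous_finsetSum _ fun σ _ =>
      (continuous_minCoord σ hcoord).mul continuous_const)
  · obtain ⟨x, hx, h⟩ := hsupp t σ hσ hσt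
    exact ⟨x, hx, fun y hy => h y (Finsupp.mem_support_iff.1 hy)⟩

/-- The straight-line homotopy, as a homotopy that stays in `|L|` on a set of points. -/
theorem homotopyWith_straightLine {T : Type v} [TopologicalSpace T] {f₀ f₁ : C(T, Realization K)}
    (B : Set T) (W : Finset V)
    (hW₀ : ∀ t, (f₀ t).1.support ⊆ W) (hW₁ : ∀ t, (f₁ t).1.support ⊆ W)
    (hc : ∀ t, ∃ ρ ∈ K, (f₀ t).1.support ⊆ ρ ∧ (f₁ t).1.support ⊆ ρ)
    (hB : ∀ t ∈ B, ∃ ρ ∈ L, (f₀ t).1.support ⊆ ρ ∧ (f₁ t).1.support ⊆ ρ) :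
    Nonempty (f₀.HomotopyWith f₁ fun g => ∀ t ∈ B, (g t).1.support ∈ L) := by
  classical
  obtain ⟨H, hH⟩ := exists_straightLine f₀.continuous f₁.continuous W hW₀ hW₁ hc
  refine ⟨⟨⟨H, fun t => Subtype.ext ?_, fun t => Subtype.ext ?_⟩, fun s t ht => ?_⟩⟩
  · rw [ContinuousMap.toFun_eq_coe, hH]
    simp
  · rw [ContinuousMap.toFun_eq_coe, hH]
    simp
  · obtain ⟨ρ, hρ, h0, h1⟩ := hB t ht
    refine (L.isRelLowerSet_faces hρ).2 ?_ (K.isRelLowerSet_faces (H (s, t)).2.1).1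
    refine (le_of_eq (congrArg Finsupp.support (hH s t))).trans ?_
    exact Finsupp.support_add.trans (Finset.union_subset (Finsupp.support_smul.trans h0)
      (Finsupp.support_smul.trans h1))

end Transfer

/-! ### Metric geometry of separated simplices and their obstruction complexes. -/

section Gluing

variable {Z : Type u} [PseudoEMetricSpace Z] {X Y : Set Z} {r : ℝ≥0}

/-- The simplices of `VR_r(Z)` outside of the poset `P`. -/
def separatedSimplices (X Y : Set Z) (r : ℝ≥0) : Set (Finset Z) :=
  {σ | σ ∈ vietorisRips (Set.univ : Set Z) r ∧
    σ ∉ decompositionPoset (vietorisRips (Set.univ : Set Z) r) X Y}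

theorem mem_vietorisRips_univ {σ : Finset Z} : σ ∈ vietorisRips (Set.univ : Set Z) r ↔
    σ.Nonempty ∧ ∀ x ∈ σ, ∀ y ∈ σ, edist x y ≤ (r : ℝ≥0∞) :=
  ⟨fun h => ⟨h.1, h.2.2⟩, fun h => ⟨h.1, Set.subset_univ _, h.2⟩⟩

theorem mem_vietorisRips_sup {σ : Finset Z} : σ ∈ vietorisRips X r ⊔ vietorisRips Y r ↔
    σ ∈ vietorisRips (Set.univ : Set Z) r ∧ ((σ : Set Z) ⊆ X ∨ (σ : Set Z) ⊆ Y) := by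
  constructor
  · rintro (h | h)
    · exact ⟨⟨h.1, Set.subset_univ _, h.2.2⟩, Or.inl h.2.1⟩
    · exact ⟨⟨h.1, Set.subset_univ _, h.2.2⟩, Or.inr h.2.1⟩
  · rintro ⟨h, hX | hY⟩
    · exact Or.inl ⟨h.1, hX, h.2.2⟩
    · exact Or.inr ⟨h.1, hY, h.2.2⟩

theorem mem_separatedSimplices {σ : Finset Z} : σ ∈ separatedSimplices X Y r ↔
    σ ∈ vietorisRips (Set.univ : Set Z) r ∧ ¬ (σ : Set Z) ⊆ X ∧ ¬ (σ : Set Z) ⊆ Y ∧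
      ∀ v ∈ σ, v ∉ X ∩ Y := by
  refine and_congr_right fun h => ?_
  change ¬ (_ ∧ _) ↔ _
  rw [not_and, forall_prop_of_true h, not_or, not_or, Set.not_nonempty_iff_eq_empty,
    Set.eq_empty_iff_forall_notMem]
  refine and_congr_right fun _ => and_congr_right fun _ => ?_
  exact ⟨fun h v hv hA => h v ⟨hv, hA⟩, fun h v hv => h v hv.1 hv.2⟩

theorem pair_mem_separatedSimplices [DecidableEq Z] {ρ : Finset Z}
    (hρ : ρ ∈ vietorisRips (Set.univ : Set Z) r) {x y : Z} (hx : x ∈ ρ) (hy : y ∈ ρ)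
    (hxY : x ∉ Y) (hyX : y ∉ X) : ({x, y} : Finset Z) ∈ separatedSimplices X Y r := by
  refine mem_separatedSimplices.2 ⟨(PreAbstractSimplicialComplex.isRelLowerSet_faces _ hρ).2
    (Finset.insert_subset hx (Finset.singleton_subset_iff.2 hy)) (Finset.insert_nonempty _ _),
    fun h => hyX (h (by simp)), fun h => hxY (h (by simp)), fun v hv hvA => ?_⟩
  rcases Finset.mem_insert.1 hv with rfl | hv
  · exact hxY hvA.2
  · exact hyX (Finset.mem_singleton.1 hv ▸ hvA.1)

/-- The assumption speaks of edges only. A vertex of a separated simplex lies on exactly one side,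
and any vertex from the other side completes it to a separated edge. -/
theorem two_mul_edist_le (hs : StrongSimplexAssumption X Y r) {σ : Finset Z}
    (hσ : σ ∈ separatedSimplices X Y r) (hXY : X ∪ Y = Set.univ) {v a b : Z} (hv : v ∈ σ)
    (ha : a ∈ X ∩ Y) (hb : b ∈ X ∩ Y) (hav : edist a v ≤ r) (hvb : edist v b ≤ r) :
    2 * edist a b ≤ edist a v + edist v b := by
  classical
  obtain ⟨hK, hX, hY, hA⟩ := mem_separatedSimplices.1 hσ
  obtain ⟨y, hy, hyX⟩ := Set.not_subset.1 hX
  obtain ⟨x, hx, hxY⟩ := Set.not_subset.1 hY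
  have hvXY : v ∈ X ∪ Y := hXY ▸ Set.mem_univ v
  by_cases hvY : v ∈ Y
  · have hvX : v ∉ X := fun h => hA v hv ⟨h, hvY⟩
    have he := pair_mem_separatedSimplices hK hx hv hxY hvX
    exact hs _ he.1 he.2 (Finset.card_pair fun h => hxY (h ▸ hvY)) v (by simp) a ha b hb hav hvb
  · have hvX : v ∈ X := hvXY.resolve_right hvY
    have he := pair_mem_separatedSimplices hK hv hy hvY hyX
    exact hs _ he.1 he.2 (Finset.card_pair fun h => hyX (h ▸ hvX)) v (by simp) a ha b hb hav hvb

/-- The simplex assumption at any one vertex bounds twice the distance by `2r`. This is why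
obstruction complexes of separated simplices are full simplices. -/
theorem edist_le_of_mem_separated (hs : StrongSimplexAssumption X Y r) {σ : Finset Z}
    (hσ : σ ∈ separatedSimplices X Y r) (hXY : X ∪ Y = Set.univ) {a b : Z}
    (ha : a ∈ X ∩ Y) (hb : b ∈ X ∩ Y) (haσ : ∀ v ∈ σ, edist a v ≤ r)
    (hbσ : ∀ v ∈ σ, edist b v ≤ r) : edist a b ≤ r := by
  obtain ⟨v, hv⟩ := hσ.1.1
  have hvb : edist v b ≤ r := edist_comm v b ▸ hbσ v hv
  have h := two_mul_edist_le hs hσ hXY hv ha hb (haσ v hv) hvb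
  have h2 : 2 * edist a b ≤ 2 * (r : ℝ≥0∞) := by
    rw [two_mul (r : ℝ≥0∞)]
    exact h.trans (add_le_add (haσ v hv) hvb)
  exact (ENNReal.mul_le_mul_iff_right two_ne_zero ENNReal.ofNat_ne_top).1 h2

/-- Finiteness turns the infimum into a minimum; the set is nonempty since an empty infimum would be
`∞`. -/
theorem exists_edist_add_edist_le (hfin : (X ∩ Y).Finite) (hg : IsMetricGluing X Y) {x y : Z}
    (hx : x ∈ X \ (X ∩ Y)) (hy : y ∈ Y \ (X ∩ Y)) (hxy : edist x y ≤ r) :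
    ∃ a ∈ X ∩ Y, edist x a + edist a y ≤ r := by
  rw [hg.2 x hx y hy] at hxy
  have hne : (X ∩ Y).Nonempty := by
    rw [Set.nonempty_iff_ne_empty]
    intro h
    simp [h] at hxy
  obtain ⟨a, ha, hmin⟩ := Set.exists_min_image _ (fun a => edist x a + edist a y) hfin hne
  exact ⟨a, ha, (le_iInf₂ hmin).trans hxy⟩

/-- A vertex `x` of a simplex, such that all other vertices are joined to `x` by geodesics through
`A`, yields a vertex of `A` which is close to all vertices of the simplex. -/
theorem exists_close_of_forall_exists {A : Set Z} {σ : Finset Z} {x : Z} (hσ : ∃ y ∈ σ, y ≠ x)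
    (hgeo : ∀ y ∈ σ, y ≠ x → ∃ a ∈ A, edist x a + edist a y ≤ r)
    (hs : ∀ a ∈ A, ∀ b ∈ A, edist a x ≤ r → edist x b ≤ r →
      2 * edist a b ≤ edist a x + edist x b) :
    ∃ b ∈ A, ∀ v ∈ σ, edist b v ≤ r := by
  classical
  obtain ⟨y₁, hy₁, hne₁⟩ := hσ
  have : Nonempty Z := ⟨x⟩
  choose! a haA ha using hgeo
  -- The gate `a y₀` nearest to `x` is no farther from any gate `a y` than `x` is, so replacing `x`
  -- by it does not lengthen the route to `y` through `a y`.
  obtain ⟨y₀, hy₀, hmin⟩ := Finset.exists_min_image (σ.erase x) (fun y => edist x (a y))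
    ⟨y₁, Finset.mem_erase.2 ⟨hne₁, hy₁⟩⟩
  obtain ⟨hne₀, hy₀⟩ := Finset.mem_erase.1 hy₀
  refine ⟨a y₀, haA _ hy₀ hne₀, fun y hy => ?_⟩
  have hb : edist (a y₀) x ≤ r := by
    rw [edist_comm]
    exact le_self_add.trans (ha _ hy₀ hne₀)
  by_cases hyx : y = x
  · rwa [hyx]
  have hmin' := hmin y (Finset.mem_erase.2 ⟨hyx, hy⟩)
  have h2 : 2 * edist (a y₀) (a y) ≤ 2 * edist x (a y) := by
    refine (hs _ (haA _ hy₀ hne₀) _ (haA _ hy hyx) hb (le_self_add.trans (ha _ hy hyx))).trans ?_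
    rw [two_mul, edist_comm (a y₀) x]
    exact add_le_add hmin' le_rfl
  have h3 := (ENNReal.mul_le_mul_iff_right two_ne_zero ENNReal.ofNat_ne_top).1 h2
  exact (edist_triangle _ (a y) _).trans ((add_le_add h3 le_rfl).trans (ha _ hy hyx))

theorem exists_close_of_ncard_eq_one (hfin : (X ∩ Y).Finite) (hg : IsMetricGluing X Y)
    (hs : StrongSimplexAssumption X Y r) {σ : Finset Z} (hσ : σ ∈ separatedSimplices X Y r)
    (h1 : ((σ : Set Z) ∩ X).ncard = 1 ∨ ((σ : Set Z) ∩ Y).ncard = 1) :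
    ∃ b ∈ X ∩ Y, ∀ v ∈ σ, edist b v ≤ r := by
  obtain ⟨hK, hX, hY, hA⟩ := mem_separatedSimplices.1 hσ
  obtain ⟨y₀, hy₀, hy₀X⟩ := Set.not_subset.1 hX
  obtain ⟨x₀, hx₀, hx₀Y⟩ := Set.not_subset.1 hY
  have hXY : ∀ v, v ∈ X ∨ v ∈ Y := fun v => (hg.1 ▸ Set.mem_univ v : v ∈ X ∪ Y)
  rcases h1 with h1 | h1 <;> obtain ⟨x, hx⟩ := Set.ncard_eq_one.1 h1
  · have hx' : x ∈ (σ : Set Z) ∩ X := hx ▸ rfl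
    refine exists_close_of_forall_exists ⟨y₀, hy₀, fun h => hy₀X (h ▸ hx'.2)⟩ (fun y hy hyx => ?_)
      fun a ha b hb h1 h2 => two_mul_edist_le hs hσ hg.1 hx'.1 ha hb h1 h2
    have hyX : y ∉ X := fun h => hyx (hx ▸ (⟨hy, h⟩ : y ∈ (σ : Set Z) ∩ X) : y ∈ ({x} : Set Z))
    exact exists_edist_add_edist_le hfin hg ⟨hx'.2, hA x hx'.1⟩
      ⟨(hXY y).resolve_left hyX, hA y hy⟩ (hK.2.2 x hx'.1 y hy)
  · have hx' : x ∈ (σ : Set Z) ∩ Y := hx ▸ rfl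
    refine exists_close_of_forall_exists ⟨x₀, hx₀, fun h => hx₀Y (h ▸ hx'.2)⟩ (fun y hy hyx => ?_)
      fun a ha b hb h1 h2 => two_mul_edist_le hs hσ hg.1 hx'.1 ha hb h1 h2
    have hyY : y ∉ Y := fun h => hyx (hx ▸ (⟨hy, h⟩ : y ∈ (σ : Set Z) ∩ Y) : y ∈ ({x} : Set Z))
    obtain ⟨a, ha, h⟩ := exists_edist_add_edist_le hfin hg
      ⟨(hXY y).resolve_right hyY, hA y hy⟩ ⟨hx'.2, hA x hx'.1⟩ (hK.2.2 y hy x hx'.1)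
    exact ⟨a, ha, by rwa [add_comm, edist_comm a x, edist_comm y a] at h⟩

/-- At most three vertices split into two nonempty sides, so one side is a single vertex. -/
theorem exists_close_of_card_le_three (hfin : (X ∩ Y).Finite) (hg : IsMetricGluing X Y)
    (hs : StrongSimplexAssumption X Y r) {σ : Finset Z} (hσ : σ ∈ separatedSimplices X Y r)
    (h3 : σ.card ≤ 3) : ∃ b ∈ X ∩ Y, ∀ v ∈ σ, edist b v ≤ r := by
  classical
  obtain ⟨hK, hX, hY, hA⟩ := mem_separatedSimplices.1 hσ
  refine exists_close_of_ncard_eq_one hfin hg hs hσ ?_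
  have e : ∀ S : Set Z, ((σ : Set Z) ∩ S).ncard = (σ.filter (· ∈ S)).card := fun S => by
    rw [← Set.ncard_coe_finset, Finset.coe_filter]
    rfl
  rw [e, e]
  obtain ⟨y₀, hy₀, hy₀X⟩ := Set.not_subset.1 hX
  obtain ⟨x₀, hx₀, hx₀Y⟩ := Set.not_subset.1 hY
  have hXY : ∀ v, v ∈ X ∨ v ∈ Y := fun v => (hg.1 ▸ Set.mem_univ v : v ∈ X ∪ Y)
  have p1 : 0 < (σ.filter (· ∈ X)).card :=
    Finset.card_pos.2 ⟨x₀, Finset.mem_filter.2 ⟨hx₀, (hXY x₀).resolve_right hx₀Y⟩⟩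
  have p2 : 0 < (σ.filter (· ∈ Y)).card :=
    Finset.card_pos.2 ⟨y₀, Finset.mem_filter.2 ⟨hy₀, (hXY y₀).resolve_left hy₀X⟩⟩
  have p3 : (σ.filter (· ∈ X)).card + (σ.filter (· ∈ Y)).card ≤ σ.card := by
    rw [← Finset.card_union_of_disjoint]
    · exact Finset.card_le_card
        (Finset.union_subset (Finset.filter_subset _ _) (Finset.filter_subset _ _))
    · exact Finset.disjoint_left.2 fun v h1 h2 => hA v (Finset.mem_filter.1 h1).1
        ⟨(Finset.mem_filter.1 h1).2, (Finset.mem_filter.1 h2).2⟩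
  omega

/-- The complex consists of all nonempty finite sets of points of `X ∩ Y` close to `σ`. It contains
the vertex `b`, and straight lines contract it to `b`. -/
theorem contractibleSpace_obstructionComplex (hfin : (X ∩ Y).Finite) (hg : IsMetricGluing X Y)
    (hs : StrongSimplexAssumption X Y r) {σ : Finset Z} (hσ : σ ∈ separatedSimplices X Y r)
    (h1 : ((σ : Set Z) ∩ X).ncard = 1 ∨ ((σ : Set Z) ∩ Y).ncard = 1) :
    ContractibleSpace (Realization
      (obstructionComplex (vietorisRips (Set.univ : Set Z) r) σ (X ∩ Y))) := by
  classical
  obtain ⟨b, hb, hbσ⟩ := exists_close_of_ncard_eq_one hfin hg hs hσ h1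
  set S := obstructionComplex (vietorisRips (Set.univ : Set Z) r) σ (X ∩ Y)
  have hmem : ∀ μ : Finset Z, μ.Nonempty → (∀ a ∈ μ, a ∈ X ∩ Y ∧ ∀ v ∈ σ, edist a v ≤ r) →
      μ ∈ S := by
    refine fun μ hμ h => ⟨fun a ha => (h a ha).1, hμ, mem_vietorisRips_univ.2
      ⟨hμ.mono ?_, fun x hx y hy => ?_⟩⟩
    · convert! Finset.subset_union_left (s₁ := μ) (s₂ := σ)
    have hx' : x ∈ μ ∪ σ := by convert! hx
    have hy' : y ∈ μ ∪ σ := by convert! hy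
    rcases Finset.mem_union.1 hx' with hx | hx <;> rcases Finset.mem_union.1 hy' with hy | hy
    · exact edist_le_of_mem_separated hs hσ hg.1 (h x hx).1 (h y hy).1 (h x hx).2 (h y hy).2
    · exact (h x hx).2 y hy
    · exact edist_comm x y ▸ (h y hy).2 x hx
    · exact hσ.1.2.2 x hx y hy
  have hvert : ∀ μ ∈ S, ∀ a ∈ μ, a ∈ X ∩ Y ∧ ∀ v ∈ σ, edist a v ≤ r := by
    rintro μ ⟨hA, -, hK⟩ a ha
    refine ⟨hA ha, fun v hv => hK.2.2 a ?_ v ?_⟩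
    · convert! Finset.mem_union_left σ ha
    · convert! Finset.mem_union_right μ hv
  have hb1 : ∑ x ∈ {b}, Finsupp.single b (1 : ℝ) x = 1 := by simp
  have hbS : {b} ∈ S := hmem {b} (Finset.singleton_nonempty b) fun a ha => by
    rw [Finset.mem_singleton.1 ha]
    exact ⟨hb, hbσ⟩
  let p₀ : Realization S := ⟨Finsupp.single b 1, mem_realization_of
    Finsupp.support_single_subset hbS Finsupp.support_single_subset (fun x => by
      rw [Finsupp.single_apply]; split_ifs <;> norm_num) hb1⟩
  have hp₀ : p₀.1.support ⊆ {b} := Finsupp.support_single_subset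
  have hW : ∀ p : Realization S, p.1.support ⊆ hfin.toFinset := fun p a ha =>
    hfin.mem_toFinset.2 (hvert _ p.2.1 a ha).1
  obtain ⟨H⟩ := homotopyWith_straightLine (K := S) (L := S) (f₀ := ContinuousMap.id _)
    (f₁ := ContinuousMap.const _ p₀) ∅ hfin.toFinset hW (fun _ => hW p₀)
    (fun p => ⟨insert b p.1.support, hmem _ (Finset.insert_nonempty _ _) fun a ha => by
        rcases Finset.mem_insert.1 ha with rfl | ha
        · exact ⟨hb, hbσ⟩
        · exact hvert _ p.2.1 a ha,
      Finset.subset_insert _ _, hp₀.trans (Finset.singleton_subset_iff.2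
        (Finset.mem_insert_self _ _))⟩) (fun p hp => hp.elim)
  exact (contractible_iff_id_nullhomotopic _).2 ⟨p₀, ⟨H.toHomotopy⟩⟩

end Gluing

/-! ### Deforming maps from the square into the union of the two Vietoris-Rips complexes. -/

section Compression

variable {Z : Type u} [PseudoEMetricSpace Z] {X Y : Set Z} {r : ℝ≥0}

/-- Every map from the square to `|VR_r(Z)|` is homotopic to a map into `|VR_r(X) ∪ VR_r(Y)|`, by a
homotopy which keeps in this subspace what is there from the beginning. -/
theorem exists_homotopyWith_square (hfin : (X ∩ Y).Finite) (hg : IsMetricGluing X Y)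
    (hs : StrongSimplexAssumption X Y r) :
    ∀ φ : C(Square, Realization (vietorisRips (Set.univ : Set Z) r)),
    ∃ ψ : C(Square, Realization (vietorisRips (Set.univ : Set Z) r)),
      (∀ z, (ψ z).1.support ∈ vietorisRips X r ⊔ vietorisRips Y r) ∧
      Nonempty (φ.HomotopyWith ψ fun g =>
        ∀ z ∈ {z | (φ z).1.support ∈ vietorisRips X r ⊔ vietorisRips Y r},
          (g z).1.support ∈ vietorisRips X r ⊔ vietorisRips Y r) := by
  classical
  set K := vietorisRips (Set.univ : Set Z) r
  set L := vietorisRips X r ⊔ vietorisRips Y r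
  set N := separatedSimplices X Y r
  intro φ
  have hXY : ∀ v, v ∈ X ∨ v ∈ Y := fun v => (hg.1 ▸ Set.mem_univ v : v ∈ X ∪ Y)
  have hLsub : ∀ {ρ σ : Finset Z}, ρ ∈ L → σ ∈ N → ¬ σ ⊆ ρ := by
    intro ρ σ hρ hσ h
    obtain ⟨-, hX, hY, -⟩ := mem_separatedSimplices.1 hσ
    rcases (mem_vietorisRips_sup.1 hρ).2 with h' | h'
    · exact hX ((Finset.coe_subset.2 h).trans h')
    · exact hY ((Finset.coe_subset.2 h).trans h')
  obtain ⟨φ₀, hφ₀, hφ₀φ, hφ₀3⟩ := exists_approximation_card_le_three φ.continuous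
  obtain ⟨W, hW⟩ := exists_finset_support_subset_of_compactSpace φ.continuous
  have hW₀ : ∀ z, (φ₀ z).1.support ⊆ W := fun z => (hφ₀φ z).trans (hW z)
  have hclose : ∀ σ : Finset Z, σ ∈ N ∧ σ.card ≤ 3 → ∃ b ∈ X ∩ Y, ∀ v ∈ σ, edist b v ≤ r :=
    fun σ h => exists_close_of_card_le_three hfin hg hs h.1 h.2
  have : Nonempty Z := (K.isRelLowerSet_faces (φ ⟨0, by simp⟩).2.1).1.to_subtype.map Subtype.val
  choose! b hbA hb using hclose
  have hbσ : ∀ σ ∈ N, σ.card ≤ 3 → b σ ∉ σ := fun σ hσ h3 h =>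
    (mem_separatedSimplices.1 hσ).2.2.2 _ h (hbA σ ⟨hσ, h3⟩)
  -- first push away from the triangles
  let S₃ : Set (Finset Z) := {σ | σ ∈ N ∧ σ.card = 3}
  have huniq₃ : ∀ z, ∀ σ ∈ S₃, σ ⊆ (φ₀ z).1.support → σ = (φ₀ z).1.support := fun z σ hσ h =>
    Finset.eq_of_subset_of_card_le h ((hφ₀3 z).trans hσ.2.ge)
  have hK₃ : ∀ z, ∀ σ ∈ S₃, σ ⊆ (φ₀ z).1.support → insert (b σ) (φ₀ z).1.support ∈ K := by
    intro z σ hσ h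
    rw [← huniq₃ z σ hσ h]
    have hbv := hb σ ⟨hσ.1, hσ.2.le⟩
    refine mem_vietorisRips_univ.2 ⟨Finset.insert_nonempty _ _, fun x hx y hy => ?_⟩
    rcases Finset.mem_insert.1 hx with rfl | hx <;> rcases Finset.mem_insert.1 hy with rfl | hy
    · simp
    · exact hbv y hy
    · exact edist_comm x _ ▸ hbv x hx
    · exact hσ.1.1.2.2 x hx y hy
  obtain ⟨φ₁, W₁, hφ₁, hW₁, hφ₁eq, hφ₁S⟩ := exists_transfer hφ₀ hW₀ S₃ b
    (fun σ hσ => hσ.1.1.1) (fun σ hσ => hbσ σ hσ.1 hσ.2.le)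
    (fun z σ hσ τ hτ h h' => (huniq₃ z σ hσ h).trans (huniq₃ z τ hτ h').symm) hK₃
  -- A separated triangle in the support was the whole support; it has lost a vertex and can only
  -- have gained one in `X ∩ Y`. Without such a triangle, three vertices outside `X ∩ Y` form a
  -- simplex that is not separated, hence lies in `L`.
  have hφ₁2 : ∀ z, (φ₁ z).1.support ∈ L ∨ ((φ₁ z).1.support.filter (· ∉ X ∩ Y)).card ≤ 2 := by
    intro z
    by_cases h : ∀ σ ∈ S₃, ¬ σ ⊆ (φ₀ z).1.support
    · rw [hφ₁eq z h, or_iff_not_imp_right]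
      intro h3
      have hcard := hφ₀3 z
      have hall : (φ₀ z).1.support.filter (· ∉ X ∩ Y) = (φ₀ z).1.support :=
        Finset.eq_of_subset_of_card_le (Finset.filter_subset _ _) (by omega)
      rw [hall] at h3
      refine mem_vietorisRips_sup.2 ⟨(φ₀ z).2.1, ?_⟩
      by_contra hcon
      rw [not_or] at hcon
      refine h _ ⟨mem_separatedSimplices.2 ⟨(φ₀ z).2.1, hcon.1, hcon.2, fun v hv => ?_⟩,
        by omega⟩ subset_rfl
      rw [← hall] at hv
      exact (Finset.mem_filter.1 hv).2
    · push Not at h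
      obtain ⟨σ, hσ, hσz⟩ := h
      obtain ⟨x, hx, hsub⟩ := hφ₁S z σ hσ hσz
      right
      have : (φ₁ z).1.support.filter (· ∉ X ∩ Y) ⊆ σ.erase x := by
        intro v hv
        obtain ⟨hv, hvA⟩ := Finset.mem_filter.1 hv
        rw [huniq₃ z σ hσ hσz]
        refine (Finset.mem_insert.1 (hsub hv)).resolve_left fun h => hvA ?_
        exact h ▸ hbA σ ⟨hσ.1, hσ.2.le⟩
      refine (Finset.card_le_card this).trans ?_
      rw [Finset.card_erase_of_mem hx, hσ.2]
  -- then push away from the edges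
  let S₂ : Set (Finset Z) := {σ | σ ∈ N ∧ σ.card = 2}
  have huniq₂ : ∀ z, ∀ σ ∈ S₂, σ ⊆ (φ₁ z).1.support →
      σ = (φ₁ z).1.support.filter (· ∉ X ∩ Y) := by
    intro z σ hσ h
    refine Finset.eq_of_subset_of_card_le (fun v hv => Finset.mem_filter.2 ⟨h hv,
      (mem_separatedSimplices.1 hσ.1).2.2.2 v hv⟩) ?_
    exact hσ.2 ▸ (hφ₁2 z).resolve_left fun hL => hLsub hL hσ.1 h
  have hK₂ : ∀ z, ∀ σ ∈ S₂, σ ⊆ (φ₁ z).1.support → insert (b σ) (φ₁ z).1.support ∈ K := by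
    intro z σ hσ h
    have hbv := hb σ ⟨hσ.1, by have := hσ.2; omega⟩
    have hbA' := hbA σ ⟨hσ.1, by have := hσ.2; omega⟩
    -- Vertices outside `X ∩ Y` belong to `σ`. Those in `X ∩ Y` are close to all of `σ`, as is `b
    -- σ`, so they are close to `b σ`.
    have hd : ∀ x ∈ (φ₁ z).1.support, edist (b σ) x ≤ r := by
      intro x hx
      by_cases hxA : x ∈ X ∩ Y
      · exact edist_le_of_mem_separated hs hσ.1 hg.1 hbA' hxA hbv
          fun v hv => (φ₁ z).2.1.2.2 x hx v (h hv)
      · refine hbv x ?_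
        rw [huniq₂ z σ hσ h]
        exact Finset.mem_filter.2 ⟨hx, hxA⟩
    refine mem_vietorisRips_univ.2 ⟨Finset.insert_nonempty _ _, fun x hx y hy => ?_⟩
    rcases Finset.mem_insert.1 hx with rfl | hx <;> rcases Finset.mem_insert.1 hy with rfl | hy
    · simp
    · exact hd y hy
    · exact edist_comm x _ ▸ hd x hx
    · exact (φ₁ z).2.1.2.2 x hx y hy
  obtain ⟨φ₂, W₂, hφ₂, hW₂, hφ₂eq, hφ₂S⟩ := exists_transfer hφ₁ hW₁ S₂ b
    (fun σ hσ => hσ.1.1.1) (fun σ hσ => hbσ σ hσ.1 (by have := hσ.2; omega))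
    (fun z σ hσ τ hτ h h' => (huniq₂ z σ hσ h).trans (huniq₂ z τ hτ h').symm) hK₂
  have hφ₂L : ∀ z, (φ₂ z).1.support ∈ L := by
    intro z
    refine mem_vietorisRips_sup.2 ⟨(φ₂ z).2.1, ?_⟩
    by_cases h : ∀ σ ∈ S₂, ¬ σ ⊆ (φ₁ z).1.support
    · rw [hφ₂eq z h]
      by_contra hcon
      rw [not_or] at hcon
      obtain ⟨y, hy, hyX⟩ := Set.not_subset.1 hcon.1
      obtain ⟨x, hx, hxY⟩ := Set.not_subset.1 hcon.2
      exact h _ ⟨pair_mem_separatedSimplices (φ₁ z).2.1 hx hy hxY hyX,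
        Finset.card_pair fun h => hyX (h ▸ (hXY x).resolve_right hxY)⟩
        (Finset.insert_subset hx (Finset.singleton_subset_iff.2 hy))
    · push Not at h
      obtain ⟨σ, hσ, hσz⟩ := h
      obtain ⟨x, hx, hsub⟩ := hφ₂S z σ hσ hσz
      have hcard : (σ.erase x).card = 1 := by rw [Finset.card_erase_of_mem hx, hσ.2]
      obtain ⟨y, hy⟩ := Finset.card_eq_one.1 hcard
      -- One end of the edge is gone, so at most one vertex lies outside `X ∩ Y`, and the support
      -- fits on the side of that vertex.
      have hv : ∀ v ∈ (φ₂ z).1.support, v ∈ X ∩ Y ∨ v = y := by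
        intro v hv
        rw [or_iff_not_imp_left]
        intro hvA
        rcases Finset.mem_insert.1 (hsub hv) with rfl | hv'
        · exact absurd (hbA σ ⟨hσ.1, by have := hσ.2; omega⟩) hvA
        · rw [← Finset.mem_singleton, ← hy, huniq₂ z σ hσ hσz]
          exact Finset.mem_erase.2 ⟨Finset.ne_of_mem_erase hv',
            Finset.mem_filter.2 ⟨Finset.mem_of_mem_erase hv', hvA⟩⟩
      rcases hXY y with hyX | hyY
      · exact Or.inl fun v hv' => (hv v hv').elim (fun h => h.1) fun h => h ▸ hyX
      · exact Or.inr fun v hv' => (hv v hv').elim (fun h => h.2) fun h => h ▸ hyY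
  -- the three homotopies
  let B : Set Square := {z | (φ z).1.support ∈ L}
  have hB₀ : ∀ z ∈ B, (φ₀ z).1.support ∈ L := fun z hz =>
    (L.isRelLowerSet_faces hz).2 (hφ₀φ z) (K.isRelLowerSet_faces (φ₀ z).2.1).1
  -- A simplex of `L` has no separated face, so neither transfer moves these points.
  have hB₁ : ∀ z ∈ B, φ₁ z = φ₀ z := fun z hz =>
    hφ₁eq z fun σ hσ => hLsub (hB₀ z hz) hσ.1
  have hB₂ : ∀ z ∈ B, φ₂ z = φ₁ z := fun z hz =>
    hφ₂eq z fun σ hσ => hLsub (by rw [hB₁ z hz]; exact hB₀ z hz) hσ.1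
  obtain ⟨H₀⟩ := homotopyWith_straightLine (L := L) (f₀ := φ) (f₁ := ⟨φ₀, hφ₀⟩) B W hW hW₀
    (fun z => ⟨_, (φ z).2.1, subset_rfl, hφ₀φ z⟩) fun z hz => ⟨_, hz, subset_rfl, hφ₀φ z⟩
  have hsub1 : ∀ z, ∃ ρ ∈ K, (φ₀ z).1.support ⊆ ρ ∧ (φ₁ z).1.support ⊆ ρ := by
    intro z
    by_cases h : ∀ σ ∈ S₃, ¬ σ ⊆ (φ₀ z).1.support
    · exact ⟨_, (φ₀ z).2.1, subset_rfl, by rw [hφ₁eq z h]⟩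
    · push Not at h
      obtain ⟨σ, hσ, hσz⟩ := h
      obtain ⟨x, -, hsub⟩ := hφ₁S z σ hσ hσz
      exact ⟨_, hK₃ z σ hσ hσz, Finset.subset_insert _ _,
        hsub.trans (Finset.insert_subset_insert _ (Finset.erase_subset _ _))⟩
  have hsub2 : ∀ z, ∃ ρ ∈ K, (φ₁ z).1.support ⊆ ρ ∧ (φ₂ z).1.support ⊆ ρ := by
    intro z
    by_cases h : ∀ σ ∈ S₂, ¬ σ ⊆ (φ₁ z).1.support
    · exact ⟨_, (φ₁ z).2.1, subset_rfl, by rw [hφ₂eq z h]⟩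
    · push Not at h
      obtain ⟨σ, hσ, hσz⟩ := h
      obtain ⟨x, -, hsub⟩ := hφ₂S z σ hσ hσz
      exact ⟨_, hK₂ z σ hσ hσz, Finset.subset_insert _ _,
        hsub.trans (Finset.insert_subset_insert _ (Finset.erase_subset _ _))⟩
  obtain ⟨H₁⟩ := homotopyWith_straightLine (L := L) (f₀ := ⟨φ₀, hφ₀⟩) (f₁ := ⟨φ₁, hφ₁⟩) B (W ∪ W₁)
    (fun z => (hW₀ z).trans Finset.subset_union_left)
    (fun z => (hW₁ z).trans Finset.subset_union_right) hsub1
    fun z hz => ⟨_, hB₀ z hz, subset_rfl, (congrArg (fun p => p.1.support) (hB₁ z hz)).le⟩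
  obtain ⟨H₂⟩ := homotopyWith_straightLine (L := L) (f₀ := ⟨φ₁, hφ₁⟩) (f₁ := ⟨φ₂, hφ₂⟩) B (W₁ ∪ W₂)
    (fun z => (hW₁ z).trans Finset.subset_union_left)
    (fun z => (hW₂ z).trans Finset.subset_union_right) hsub2
    fun z hz => ⟨_, hφ₂L z, (congrArg (fun p => p.1.support) (hB₂ z hz)).ge, subset_rfl⟩
  exact ⟨⟨φ₂, hφ₂⟩, hφ₂L, ⟨(H₀.trans H₁).trans H₂⟩⟩

/-- Maps from the unit ball of `E` to `T` can be deformed into `B`, by a homotopy that keeps in `B`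
what is there from the beginning. -/
def HasFreeCompression (E : Type*) [NormedAddCommGroup E] {T : Type*} [TopologicalSpace T]
    (B : Set T) : Prop :=
  ∀ φ : E → T, Continuous φ → ∃ H : ℝ × E → T, Continuous H ∧ ∀ z, ‖z‖ ≤ 1 →
    H (0, z) = φ z ∧ H (1, z) ∈ B ∧ ∀ s, φ z ∈ B → H (s, z) ∈ B

/-- Maps of pairs from the unit ball of `E` and its boundary to `T` and `B` can be deformed into `B`
relative to the boundary. -/
def HasCompression (E : Type*) [NormedAddCommGroup E] {T : Type*} [TopologicalSpace T]
    (B : Set T) : Prop :=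
  ∀ φ : E → T, Continuous φ → (∀ z, ‖z‖ = 1 → φ z ∈ B) →
    ∃ H : ℝ × E → T, Continuous H ∧ ∀ z, ‖z‖ ≤ 1 →
      H (0, z) = φ z ∧ H (1, z) ∈ B ∧ (‖z‖ = 1 → ∀ s, 0 ≤ s → s ≤ 1 → H (s, z) = φ z)

/-- The free homotopy moves the boundary inside `B`, and this motion can be absorbed in a collar. At
time `s` the ball is shrunk to radius `1 - s / 2`, and the collar outside it carries the motion of
the boundary, at time `2 - 2‖z‖`. At the end the collar lies in `B`, and the boundary itself has
stayed at time 0. -/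
theorem HasFreeCompression.hasCompression {E : Type*} [NormedAddCommGroup E] [NormedSpace ℝ E]
    {T : Type*} [TopologicalSpace T] {B : Set T} (h : HasFreeCompression E B) :
    HasCompression E B := by
  intro φ hφ hB
  obtain ⟨H, hH, hHφ⟩ := h φ hφ
  let c : ℝ × E → ℝ := fun p => max (max ‖p.2‖ (1 - p.1 / 2)) (1 / 2)
  have hc : ∀ p, 0 < c p := fun p => lt_max_of_lt_right (by norm_num)
  have hcc : Continuous c := by fun_prop
  refine ⟨fun p => H (min p.1 (2 - 2 * ‖p.2‖), (c p)⁻¹ • p.2), hH.comp (.prodMk (by fun_prop)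
    ((hcc.inv₀ fun p => (hc p).ne').smul continuous_snd)), fun z hz => ⟨?_, ?_, fun hz1 s h0 h1 => ?_⟩⟩
  · have e : c (0, z) = 1 := by
      have : max ‖z‖ (1 - 0 / 2) = 1 := by
        rw [max_eq_right] <;> linarith
      simp only [c]
      rw [this]
      norm_num
    simp only [e]
    rw [min_eq_left (by linarith), inv_one, one_smul]
    exact (hHφ z hz).1
  · by_cases hz' : ‖z‖ ≤ 1 / 2
    · have e : c (1, z) = 1 / 2 := by
        simp only [c]
        rw [max_eq_right]
        exact max_le hz' (by norm_num)
      simp only [e]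
      rw [min_eq_left (by linarith)]
      refine (hHφ _ ?_).2.1
      rw [norm_smul]
      norm_num
      linarith
    · push Not at hz'
      have e : c (1, z) = ‖z‖ := by
        simp only [c]
        rw [max_eq_left (le_max_of_le_left hz'.le), max_eq_left]
        linarith
      simp only [e]
      have hn : ‖‖z‖⁻¹ • z‖ = 1 := by
        rw [norm_smul, norm_inv, norm_norm, inv_mul_cancel₀]
        linarith
      exact (hHφ _ hn.le).2.2 _ (hB _ hn)
  · have e : c (s, z) = 1 := by
      simp only [c, hz1]
      rw [max_eq_left (by linarith : 1 - s / 2 ≤ 1), max_eq_left (by norm_num)]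
    simp only [e, hz1]
    rw [min_eq_right (by linarith), inv_one, one_smul]
    norm_num
    exact (hHφ z hz).1

theorem HasFreeCompression.of_prod {T : Type*} [TopologicalSpace T] {B : Set T}
    (h : HasFreeCompression (ℝ × ℝ) B) : HasFreeCompression ℝ B := by
  intro φ hφ
  obtain ⟨H, hH, hHφ⟩ := h (fun z => φ z.1) (hφ.comp continuous_fst)
  refine ⟨fun p => H (p.1, (p.2, 0)), hH.comp (by fun_prop), fun z hz => hHφ (z, 0) ?_⟩
  simpa [Prod.norm_def] using hz

/-- The set of points of `|VR_r(Z)|` that lie in `|VR_r(X) ∪ VR_r(Y)|`. -/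
def ripsRange (X Y : Set Z) (r : ℝ≥0) : Set (Realization (vietorisRips (Set.univ : Set Z) r)) :=
  {p | p.1.support ∈ vietorisRips X r ⊔ vietorisRips Y r}

/-- Radial retraction onto the square and clamping of time extend the homotopy to the whole plane
and all real times, where it can be reparametrized freely. -/
theorem hasFreeCompression_ripsRange (hfin : (X ∩ Y).Finite) (hg : IsMetricGluing X Y)
    (hs : StrongSimplexAssumption X Y r) : HasFreeCompression (ℝ × ℝ) (ripsRange X Y r) := by
  intro φ hφ
  obtain ⟨ψ, hψ, ⟨H⟩⟩ := exists_homotopyWith_square hfin hg hs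
    ⟨fun z => φ z.1, hφ.comp continuous_subtype_val⟩
  have hpos : ∀ z : ℝ × ℝ, 0 < max 1 ‖z‖ := fun z => lt_max_of_lt_left one_pos
  let ρ : ℝ × ℝ → Square := fun z => ⟨(max 1 ‖z‖)⁻¹ • z, by
    rw [mem_closedBall_zero_iff, norm_smul, norm_inv, Real.norm_of_nonneg (hpos z).le,
      inv_mul_le_one₀ (hpos z)]
    exact le_max_right _ _⟩
  have hρ : Continuous ρ := by
    refine Continuous.subtype_mk (.smul (.inv₀ (by fun_prop) fun z => (hpos z).ne') continuous_id) _
  have hρz : ∀ z, ‖z‖ ≤ 1 → (ρ z).1 = z := fun z hz => by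
    simp only [ρ, max_eq_left hz, inv_one, one_smul]
  refine ⟨fun p => H (Set.projIcc 0 1 zero_le_one p.1, ρ p.2), H.continuous.comp
    (.prodMk (continuous_projIcc.comp continuous_fst) (hρ.comp continuous_snd)),
    fun z hz => ⟨?_, ?_, fun s hzB => ?_⟩⟩
  · simp only [Set.projIcc_left]
    refine (H.apply_zero _).trans (congrArg φ (hρz z hz))
  · simp only [Set.projIcc_right]
    exact (congrArg (· ∈ ripsRange X Y r) (H.apply_one _)).mpr (hψ _)
  · refine H.prop' (Set.projIcc 0 1 zero_le_one s) (ρ z) ?_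
    change φ (ρ z).1 ∈ ripsRange X Y r
    rwa [hρz z hz]

end Compression

/-! ### Passing between the unit interval and the ball `[-1, 1]`. -/

section Interval

/-- The affine map from the unit interval to `[-1, 1]`. -/
def centered (a : unitInterval) : ℝ := 2 * a - 1

/-- The affine map from `[-1, 1]` to the unit interval, extended to the real line. -/
noncomputable def uncentered (v : ℝ) : unitInterval :=
  Set.projIcc 0 1 zero_le_one ((v + 1) / 2)

theorem continuous_centered : Continuous centered := by
  unfold centered
  fun_prop

theorem continuous_uncentered : Continuous uncentered :=
  continuous_projIcc.comp (by fun_prop)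

theorem uncentered_centered (a : unitInterval) : uncentered (centered a) = a := by
  have : (centered a + 1) / 2 = a := by
    rw [centered]
    ring
  rw [uncentered, this, Set.projIcc_val]

theorem centered_zero : centered 0 = -1 := by norm_num [centered]

theorem centered_one : centered 1 = 1 := by norm_num [centered]

theorem uncentered_neg_one : uncentered (-1) = 0 := by
  rw [← centered_zero, uncentered_centered]

theorem uncentered_one : uncentered 1 = 1 := by
  rw [← centered_one, uncentered_centered]

theorem norm_centered_le (a : unitInterval) : ‖centered a‖ ≤ 1 := by
  have h0 := a.2.1
  have h1 := a.2.2
  rw [Real.norm_eq_abs, abs_le, centered]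
  constructor <;> linarith

theorem norm_centered_eq_one {a : unitInterval} (h : a = 0 ∨ a = 1) : ‖centered a‖ = 1 := by
  rcases h with rfl | rfl
  · rw [centered_zero, norm_neg, norm_one]
  · rw [centered_one, norm_one]

theorem norm_pair_centered_le (a b : unitInterval) : ‖(centered a, centered b)‖ ≤ 1 :=
  max_le (norm_centered_le a) (norm_centered_le b)

theorem norm_pair_centered_eq_one {a b : unitInterval} (h : (a = 0 ∨ a = 1) ∨ b = 0 ∨ b = 1) :
    ‖(centered a, centered b)‖ = 1 := by
  rw [Prod.norm_def]
  rcases h with h | h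
  · rw [norm_centered_eq_one h]
    exact max_eq_left (norm_centered_le b)
  · rw [norm_centered_eq_one h]
    exact max_eq_right (norm_centered_le a)

theorem eq_or_eq_neg_of_norm_eq_one {v : ℝ} (h : ‖v‖ = 1) : v = 1 ∨ v = -1 :=
  (abs_eq zero_le_one).1 h

end Interval

/-! ### Consequences of compression for π₀, π₁ and π₂. -/

section Connectivity

variable {S : Type u} {T : Type v} [TopologicalSpace S] [TopologicalSpace T]

/-- Injective continuous maps `f` through which continuous maps from compact spaces factor, and such
that all maps from the square can be deformed into the range of `f`. -/
structure IsSquareCompressible (f : C(S, T)) : Prop where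
  injective : Function.Injective f
  continuous_of_comp : ∀ {D : Type} [TopologicalSpace D] [CompactSpace D] {g : D → S},
    Continuous (fun d => f (g d)) → Continuous g
  hasFreeCompression : HasFreeCompression (ℝ × ℝ) (Set.range f)

namespace IsSquareCompressible

variable {f : C(S, T)} (hf : IsSquareCompressible f)

include hf

theorem exists_lift {D : Type} [TopologicalSpace D] [CompactSpace D] {g : D → T}
    (hg : Continuous g) (h : ∀ d, g d ∈ Set.range f) : ∃ k : C(D, S), ∀ d, f (k d) = g d := by
  choose k hk using h
  exact ⟨⟨k, hf.continuous_of_comp (by simpa only [hk] using hg)⟩, hk⟩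

theorem exists_joined (t : T) : ∃ s, Joined (f s) t := by
  obtain ⟨H, hH, h⟩ := hf.hasFreeCompression (fun _ => t) continuous_const
  obtain ⟨h0, ⟨s, hs⟩, -⟩ := h 0 (by simp)
  exact ⟨s, .symm ⟨⟨⟨fun a => H (a, 0), hH.comp (by fun_prop)⟩, by simpa using h0,
    by simpa using hs.symm⟩⟩⟩

/-- Compress `γ` relative to its ends; injectivity of `f` fixes the ends of the lift. This gives
injectivity on π₀ and surjectivity on π₁. -/
theorem exists_path {s₀ s₁ : S} (γ : Path (f s₀) (f s₁)) :
    ∃ δ : Path s₀ s₁, (δ.map f.continuous).Homotopic γ := by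
  obtain ⟨H, hH, h⟩ := hf.hasFreeCompression.of_prod.hasCompression (fun v => γ (uncentered v))
    (γ.continuous.comp continuous_uncentered) fun v hv => by
      rcases eq_or_eq_neg_of_norm_eq_one hv with rfl | rfl
      · exact ⟨s₁, by rw [uncentered_one, γ.target]⟩
      · exact ⟨s₀, by rw [uncentered_neg_one, γ.source]⟩
  have hbd : ∀ (s a : unitInterval), a = 0 ∨ a = 1 → H (s, centered a) = γ a := fun s a ha => by
    rw [(h _ (norm_centered_le a)).2.2 (norm_centered_eq_one ha) s s.2.1 s.2.2,
      uncentered_centered]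
  have hHc : Continuous fun p : unitInterval × unitInterval => H (p.1, centered p.2) :=
    hH.comp ((continuous_subtype_val.comp continuous_fst).prodMk
      (continuous_centered.comp continuous_snd))
  obtain ⟨k, hk⟩ := hf.exists_lift (D := unitInterval) (g := fun a => H (1, centered a))
    (hH.comp (continuous_const.prodMk continuous_centered)) fun a => (h _ (norm_centered_le a)).2.1
  have hk0 : k 0 = s₀ := hf.injective (by rw [hk, ← γ.source]; exact hbd 1 0 (Or.inl rfl))
  have hk1 : k 1 = s₁ := hf.injective (by rw [hk, ← γ.target]; exact hbd 1 1 (Or.inr rfl))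
  refine ⟨⟨k, hk0, hk1⟩, Path.Homotopic.symm ⟨⟨⟨⟨_, hHc⟩, fun a => ?_, fun a => ?_⟩,
    fun s a ha => hbd s a ha⟩⟩⟩
  · exact (h _ (norm_centered_le a)).1.trans (by rw [uncentered_centered]; rfl)
  · exact (hk a).symm

/-- The homotopy is a square whose boundary lies in the range of `f`; compressed relative to the
boundary, it lifts to `S`. -/
theorem homotopic_of_map {s₀ s₁ : S} {p q : Path s₀ s₁}
    (hpq : (p.map f.continuous).Homotopic (q.map f.continuous)) : p.Homotopic q := by
  obtain ⟨F⟩ := hpq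
  have hF0 : ∀ a, F (0, a) = f (p a) := fun a => F.apply_zero a
  have hF1 : ∀ a, F (1, a) = f (q a) := fun a => F.apply_one a
  obtain ⟨H, hH, h⟩ := hf.hasFreeCompression.hasCompression
    (fun z => F (uncentered z.1, uncentered z.2))
    (F.continuous.comp ((continuous_uncentered.comp continuous_fst).prodMk
      (continuous_uncentered.comp continuous_snd))) fun z hz => by
      rw [Prod.norm_def] at hz
      rcases max_choice ‖z.1‖ ‖z.2‖ with h | h <;> rw [h] at hz <;>
        rcases eq_or_eq_neg_of_norm_eq_one hz with h | h <;> rw [h]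
      · exact ⟨q (uncentered z.2), by rw [uncentered_one, hF1]⟩
      · exact ⟨p (uncentered z.2), by rw [uncentered_neg_one, hF0]⟩
      · exact ⟨s₁, by rw [uncentered_one, Path.Homotopy.target]⟩
      · exact ⟨s₀, by rw [uncentered_neg_one, Path.Homotopy.source]⟩
  have hbd : ∀ a b : unitInterval, (a = 0 ∨ a = 1) ∨ b = 0 ∨ b = 1 →
      H (1, (centered a, centered b)) = F (a, b) := fun a b hab => by
    rw [(h _ (norm_pair_centered_le a b)).2.2 (norm_pair_centered_eq_one hab) 1 zero_le_one le_rfl,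
      uncentered_centered, uncentered_centered]
  obtain ⟨k, hk⟩ := hf.exists_lift (D := unitInterval × unitInterval)
    (g := fun z => H (1, (centered z.1, centered z.2)))
    (hH.comp (continuous_const.prodMk ((continuous_centered.comp continuous_fst).prodMk
      (continuous_centered.comp continuous_snd)))) fun z => (h _ (norm_pair_centered_le _ _)).2.1
  refine ⟨⟨⟨k, fun a => ?_, fun a => ?_⟩, fun s a ha => ?_⟩⟩ <;> refine hf.injective ?_
  · exact (hk _).trans ((hbd 0 a (by simp)).trans (hF0 a))
  · exact (hk _).trans ((hbd 1 a (by simp)).trans (hF1 a))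
  · refine (hk _).trans ((hbd s a (Or.inr ha)).trans ?_)
    rcases ha with rfl | rfl
    · exact (F.source s).trans (congrArg f p.source.symm)
    · exact (F.target s).trans (congrArg f p.target.symm)

theorem bijective_piZeroMap : Function.Bijective (piZeroMap f) := by
  constructor
  · intro x y
    obtain ⟨s₀, rfl⟩ := ZerothHomotopy.mk_surjective x
    obtain ⟨s₁, rfl⟩ := ZerothHomotopy.mk_surjective y
    intro h
    obtain ⟨γ⟩ : Joined (f s₀) (f s₁) := Quotient.exact h
    obtain ⟨δ, -⟩ := hf.exists_path γ
    exact ZerothHomotopy.sound δ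
  · intro y
    obtain ⟨t, rfl⟩ := ZerothHomotopy.mk_surjective y
    obtain ⟨s, ⟨γ⟩⟩ := hf.exists_joined t
    exact ⟨ZerothHomotopy.mk s, ZerothHomotopy.sound γ⟩

theorem bijective_fundamentalGroup_map (s : S) : Function.Bijective (FundamentalGroup.map f s) := by
  constructor
  · intro x y
    obtain ⟨p, rfl⟩ := Path.Homotopic.Quotient.mk_surjective x
    obtain ⟨q, rfl⟩ := Path.Homotopic.Quotient.mk_surjective y
    intro h
    exact Quotient.sound (hf.homotopic_of_map (Quotient.exact h))
  · intro y
    obtain ⟨γ, rfl⟩ := Path.Homotopic.Quotient.mk_surjective y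
    obtain ⟨δ, h⟩ := hf.exists_path γ
    exact ⟨Path.Homotopic.Quotient.mk δ, Quotient.sound h⟩

theorem surjective_homotopyGroupMap_two (s : S) :
    Function.Surjective (homotopyGroupMap (Fin 2) f s) := by
  rintro ⟨p⟩
  let e : ℝ × ℝ → Fin 2 → unitInterval := fun z => ![uncentered z.1, uncentered z.2]
  have he : Continuous e := continuous_pi fun i => by
    fin_cases i
    · exact continuous_uncentered.comp continuous_fst
    · exact continuous_uncentered.comp continuous_snd
  let c : (Fin 2 → unitInterval) → ℝ × ℝ := fun y => (centered (y 0), centered (y 1))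
  have hc : Continuous c := (continuous_centered.comp (continuous_apply 0)).prodMk
    (continuous_centered.comp (continuous_apply 1))
  have hec : ∀ y, e (c y) = y := fun y => by
    ext i
    fin_cases i <;> simp [e, c, uncentered_centered]
  have hcn : ∀ y, ‖c y‖ ≤ 1 := fun y => norm_pair_centered_le _ _
  have hcb : ∀ y ∈ Cube.boundary (Fin 2), ‖c y‖ = 1 := by
    rintro y ⟨i, hi⟩
    refine norm_pair_centered_eq_one ?_
    fin_cases i
    · exact Or.inl hi
    · exact Or.inr hi
  have heb : ∀ z, ‖z‖ = 1 → e z ∈ Cube.boundary (Fin 2) := by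
    intro z hz
    rw [Prod.norm_def] at hz
    rcases max_choice ‖z.1‖ ‖z.2‖ with h | h <;> rw [h] at hz <;>
      rcases eq_or_eq_neg_of_norm_eq_one hz with h | h
    · exact ⟨0, Or.inr (by simp [e, h, uncentered_one])⟩
    · exact ⟨0, Or.inl (by simp [e, h, uncentered_neg_one])⟩
    · exact ⟨1, Or.inr (by simp [e, h, uncentered_one])⟩
    · exact ⟨1, Or.inl (by simp [e, h, uncentered_neg_one])⟩
  obtain ⟨H, hH, h⟩ := hf.hasFreeCompression.hasCompression (fun z => p (e z))
    (p.1.continuous.comp he) fun z hz => ⟨s, (p.2 _ (heb z hz)).symm⟩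
  have hbd : ∀ (a : unitInterval), ∀ y ∈ Cube.boundary (Fin 2), H (a, c y) = p y := fun a y hy => by
    rw [(h _ (hcn y)).2.2 (hcb y hy) a a.2.1 a.2.2, hec]
  obtain ⟨k, hk⟩ := hf.exists_lift (D := Fin 2 → unitInterval) (g := fun y => H (1, c y))
    (hH.comp (continuous_const.prodMk hc)) fun y => (h _ (hcn y)).2.1
  have hkb : ∀ y ∈ Cube.boundary (Fin 2), k y = s := fun y hy => hf.injective
    ((hk y).trans ((hbd 1 y hy).trans (p.2 y hy)))
  refine ⟨Quotient.mk _ ⟨k, hkb⟩, Quotient.sound (GenLoop.Homotopic.symm ⟨⟨⟨⟨fun z => H (z.1, c z.2),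
    hH.comp ((continuous_subtype_val.comp continuous_fst).prodMk (hc.comp continuous_snd))⟩,
    fun y => ?_, fun y => (hk y).symm⟩, fun a y hy => hbd a y hy⟩⟩)⟩
  exact (h _ (hcn y)).1.trans (by rw [hec]; rfl)

end IsSquareCompressible

end Connectivity

/-! ### Simple connectivity of the homotopy fibers. -/

section Fiber

/-- Paths whose images under a self-map homotopic to the identity are homotopic are themselves
homotopic. -/
theorem homotopic_of_map_homotopic_id {F : Type u} [TopologicalSpace F] {R : C(F, F)}
    (H : (ContinuousMap.id F).Homotopy R) {x y : F} {p q : Path x y}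
    (h : (p.map R.continuous).Homotopic (q.map R.continuous)) : p.Homotopic q := by
  let e : ∀ x, Path x (R x) := fun x => H.evalAt x
  -- Naturality of the homotopy along `p`; the factor `e y` is cancelled afterwards.
  have key : ∀ p : Path x y, (p.trans (e y)).Homotopic ((e x).trans (p.map R.continuous)) := fun p =>
    Path.Homotopic.map_trans_evalAt H p
  have hpq : (p.trans (e y)).Homotopic (q.trans (e y)) :=
    ((key p).trans (Path.Homotopic.hcomp (.refl _) h)).trans (key q).symm
  have h' := Path.Homotopic.Quotient.eq.2 hpq
  rw [Path.Homotopic.Quotient.mk_trans, Path.Homotopic.Quotient.mk_trans] at h'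
  have h'' := congrArg (fun z => z.trans (Path.Homotopic.Quotient.mk (e y)).symm) h'
  simpa using Path.Homotopic.Quotient.eq.1 (by simpa using h'')

variable {S : Type u} {T : Type v} [TopologicalSpace S] [TopologicalSpace T] {f : C(S, T)} {t : T}

theorem continuous_fiber_point : Continuous fun x : HomotopyFiber f t => x.1.1 :=
  continuous_fst.comp continuous_subtype_val

theorem continuous_fiber_path :
    Continuous fun x : HomotopyFiber f t × unitInterval => x.1.1.2 x.2 :=
  ContinuousEval.continuous_eval.comp
    (((continuous_snd.comp continuous_subtype_val).comp continuous_fst).prodMk continuous_snd)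

/-- Maps to the homotopy fiber are given by pairs of a map and a homotopy. -/
theorem exists_map_fiber {D : Type*} [TopologicalSpace D] {g : D → S} (hg : Continuous g)
    {β : D × unitInterval → T} (hβ : Continuous β) (h0 : ∀ d, β (d, 0) = f (g d))
    (h1 : ∀ d, β (d, 1) = t) :
    ∃ G : C(D, HomotopyFiber f t), ∀ d, (G d).1.1 = g d ∧ ∀ a, (G d).1.2 a = β (d, a) :=
  ⟨⟨fun d => ⟨(g d, ContinuousMap.curry ⟨β, hβ⟩ d), h0 d, h1 d⟩,
    Continuous.subtype_mk (hg.prodMk (ContinuousMap.continuous _)) _⟩, fun _ => ⟨rfl, fun _ => rfl⟩⟩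

theorem HomotopyFiber.ext {x y : HomotopyFiber f t} (h1 : x.1.1 = y.1.1)
    (h2 : ∀ a, x.1.2 a = y.1.2 a) : x = y :=
  Subtype.ext (Prod.ext h1 (ContinuousMap.ext h2))

/-- The clamping of real numbers to the unit interval. -/
noncomputable def clamp (a : ℝ) : unitInterval := Set.projIcc 0 1 zero_le_one a

theorem continuous_clamp : Continuous clamp :=
  continuous_projIcc (h := (zero_le_one : (0 : ℝ) ≤ 1))

theorem clamp_of_le_zero {a : ℝ} (h : a ≤ 0) : clamp a = 0 := Set.projIcc_of_le_left _ h

theorem clamp_of_one_le {a : ℝ} (h : 1 ≤ a) : clamp a = 1 := Set.projIcc_of_right_le _ h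

theorem clamp_coe (a : unitInterval) : clamp a = a := Set.projIcc_val _ a

variable (f t) in
/-- The identity of the homotopy fiber is homotopic to a map that makes all paths constant on the
first half of the unit interval. -/
theorem exists_delay : ∃ R : C(HomotopyFiber f t, HomotopyFiber f t),
    Nonempty ((ContinuousMap.id _).Homotopy R) ∧
      ∀ x, (R x).1.1 = x.1.1 ∧ ∀ a : unitInterval, (R x).1.2 a = x.1.2 (clamp (4 * a - 2)) := by
  -- The time change interpolates between `a` and `4a - 2`; it is at most 0 at `a = 0` and at least
  -- 1 at `a = 1`, so the ends are preserved.
  obtain ⟨G, hG⟩ := exists_map_fiber (D := unitInterval × HomotopyFiber f t) (f := f) (t := t)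
    (g := fun z => z.2.1.1) (continuous_fiber_point.comp continuous_snd)
    (β := fun z => z.1.2.1.2 (clamp ((1 + 3 * z.1.1) * z.2 - 2 * z.1.1)))
    (continuous_fiber_path.comp ((continuous_snd.comp continuous_fst).prodMk
      (continuous_clamp.comp (by fun_prop))))
    (fun z => by
      have := z.1.2.1
      rw [clamp_of_le_zero (by simp [this])]
      exact z.2.2.1)
    (fun z => by
      have := z.1.2.1
      rw [clamp_of_one_le (by simp only [Set.Icc.coe_one]; linarith)]
      exact z.2.2.2)
  refine ⟨⟨fun x => G (1, x), by fun_prop⟩, ⟨⟨G, fun x => ?_, fun x => rfl⟩⟩, fun x =>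
    ⟨(hG _).1, fun a => ((hG _).2 a).trans ?_⟩⟩
  · refine HomotopyFiber.ext (hG _).1 fun a => ((hG _).2 a).trans ?_
    simp [clamp_coe]
  · norm_num

namespace IsSquareCompressible

variable (hf : IsSquareCompressible f)

include hf

/-- A map to `T` from the unit ball, which takes the boundary to the range of `f`, extends to a map
from the ball to the homotopy fiber over the image of the center. -/
theorem exists_fiber_extension {E : Type} [NormedAddCommGroup E] [NormedSpace ℝ E] [ProperSpace E]
    (hE : HasCompression E (Set.range f)) {ψ : E → T} (hψ : Continuous ψ)
    (hψf : ∀ z, ‖z‖ = 1 → ψ z ∈ Set.range f) (hψt : ψ 0 = t) :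
    ∃ G : C(Metric.closedBall (0 : E) 1, HomotopyFiber f t), ∀ z : Metric.closedBall (0 : E) 1,
      ‖z.1‖ = 1 → f (G z).1.1 = ψ z ∧
        ∀ a : unitInterval, (G z).1.2 a = ψ (min 1 (2 - 2 * (a : ℝ)) • z.1) := by
  obtain ⟨H, hH, h⟩ := hE ψ hψ hψf
  have hz : ∀ z : Metric.closedBall (0 : E) 1, ‖z.1‖ ≤ 1 := fun z => mem_closedBall_zero_iff.1 z.2
  obtain ⟨k, hk⟩ := hf.exists_lift (D := Metric.closedBall (0 : E) 1) (g := fun z => H (1, z.1))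
    (by fun_prop) fun z => (h _ (hz z)).2.1
  -- The path at `z` first runs the compression backwards from `f (k z)` to `ψ z`, then follows `ψ`
  -- along the ray to the center. On the boundary the first half is constant, which is why paths are
  -- delayed by `exists_delay`.
  obtain ⟨G, hG⟩ := exists_map_fiber (f := f) (t := t) k.continuous
    (β := fun p => H (max 0 (1 - 2 * (p.2 : ℝ)), min 1 (2 - 2 * (p.2 : ℝ)) • p.1.1))
    (by fun_prop) (fun z => by simpa using (hk z).symm)
    (fun z => by
      have h0 := (h 0 (by simp)).1
      norm_num
      rw [h0, hψt])
  refine ⟨G, fun z hz1 => ⟨?_, fun a => ?_⟩⟩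
  · rw [(hG z).1, hk]
    exact (h _ (hz z)).2.2 hz1 1 zero_le_one le_rfl
  · rw [(hG z).2]
    have ha0 := a.2.1
    have ha1 := a.2.2
    rcases le_total (a : ℝ) (1 / 2) with ha | ha
    · rw [min_eq_left (by linarith), one_smul, max_eq_right (by linarith)]
      exact (h _ (hz z)).2.2 hz1 _ (by linarith) (by linarith)
    · rw [max_eq_left (by linarith)]
      refine (h _ ?_).1
      rw [norm_smul, hz1, mul_one, min_eq_right (by linarith), Real.norm_eq_abs, abs_le]
      constructor <;> linarith

/-- The path of `x` followed by the reversed path of `y` is a map from `[-1, 1]` with center sent to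
`t`. Its fiber extension joins the delayed points `R x` and `R y`. -/
theorem pathConnectedSpace_fiber (t : T) : PathConnectedSpace (HomotopyFiber f t) := by
  obtain ⟨R, ⟨HR⟩, hR⟩ := exists_delay f t
  refine ⟨?_, fun x y => ?_⟩
  · obtain ⟨s, ⟨γ⟩⟩ := hf.exists_joined t
    exact ⟨⟨(s, γ.toContinuousMap), γ.source, γ.target⟩⟩
  have hxR : ∀ x, Joined x (R x) := fun x => ⟨HR.evalAt x⟩
  refine ((hxR x).trans ?_).trans (hxR y).symm
  let ψ : ℝ → T := fun v => if v ≤ 0 then x.1.2 (clamp (2 + 2 * v)) else y.1.2 (clamp (2 - 2 * v))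
  have hψ0 : ∀ v, v ≤ 0 → ψ v = x.1.2 (clamp (2 + 2 * v)) := fun v hv => if_pos hv
  have hψ1 : ∀ v, 0 < v → ψ v = y.1.2 (clamp (2 - 2 * v)) := fun v hv => if_neg hv.not_ge
  have hψ : Continuous ψ := by
    refine Continuous.if_le (x.1.2.continuous.comp (continuous_clamp.comp (by fun_prop)))
      (y.1.2.continuous.comp (continuous_clamp.comp (by fun_prop))) continuous_id
      continuous_const fun v hv => ?_
    rw [show v = 0 from hv, clamp_of_one_le (by norm_num), clamp_of_one_le (by norm_num),
      x.2.2, y.2.2]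
  have hm : ψ (-1) = f x.1.1 := by
    rw [hψ0 _ (by norm_num), clamp_of_le_zero (by norm_num), x.2.1]
  have hp : ψ 1 = f y.1.1 := by
    rw [hψ1 _ one_pos, clamp_of_le_zero (by norm_num), y.2.1]
  obtain ⟨G, hG⟩ := hf.exists_fiber_extension (t := t)
    hf.hasFreeCompression.of_prod.hasCompression hψ
    (fun v hv => by
      rcases eq_or_eq_neg_of_norm_eq_one hv with rfl | rfl
      · exact ⟨_, hp.symm⟩
      · exact ⟨_, hm.symm⟩)
    (by rw [hψ0 _ le_rfl, clamp_of_one_le (by norm_num), x.2.2])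
  refine ⟨⟨⟨fun a => G ⟨centered a, mem_closedBall_zero_iff.2 (norm_centered_le a)⟩,
    G.continuous.comp (continuous_centered.subtype_mk _)⟩, ?_, ?_⟩⟩
  · obtain ⟨h1, h2⟩ := hG ⟨centered 0, mem_closedBall_zero_iff.2 (norm_centered_le 0)⟩
      (norm_centered_eq_one (Or.inl rfl))
    refine HomotopyFiber.ext (hf.injective (h1.trans ?_)) fun a => (h2 a).trans ?_
    · rw [(hR x).1, ← hm]
      exact congrArg ψ centered_zero
    · rw [(hR x).2]
      have ha := a.2.2
      have hmin : 0 ≤ min 1 (2 - 2 * (a : ℝ)) := le_min zero_le_one (by linarith)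
      change ψ (_ * centered 0) = _
      rw [centered_zero, hψ0 _ (by linarith)]
      rcases le_total (a : ℝ) (1 / 2) with h | h
      · rw [min_eq_left (by linarith), clamp_of_le_zero (by norm_num),
          clamp_of_le_zero (by linarith)]
      · rw [min_eq_right (by linarith)]
        ring_nf
  · obtain ⟨h1, h2⟩ := hG ⟨centered 1, mem_closedBall_zero_iff.2 (norm_centered_le 1)⟩
      (norm_centered_eq_one (Or.inr rfl))
    refine HomotopyFiber.ext (hf.injective (h1.trans ?_)) fun a => (h2 a).trans ?_
    · rw [(hR y).1, ← hp]
      exact congrArg ψ centered_one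
    · rw [(hR y).2]
      have ha := a.2.2
      change ψ (_ * centered 1) = _
      rw [centered_one, mul_one]
      rcases le_total (a : ℝ) (1 / 2) with h | h
      · rw [min_eq_left (by linarith), hψ1 _ one_pos, clamp_of_le_zero (by norm_num),
          clamp_of_le_zero (by linarith)]
      · rw [min_eq_right (by linarith)]
        rcases eq_or_lt_of_le ha with h' | h'
        · rw [h', hψ0 _ (by norm_num), clamp_of_one_le (by norm_num), clamp_of_one_le (by norm_num),
            x.2.2, y.2.2]
        · rw [hψ1 _ (by linarith)]
          ring_nf

/-- Two paths `p`, `q` with common ends form a loop in the fiber. Spread over the boundary of the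
square, `p` below and `q` above, with the paths of the fiber points along the rays, it becomes a map
from the square to `T`. Its fiber extension is a homotopy between the delayed paths. -/
theorem simplyConnectedSpace_fiber (t : T) : SimplyConnectedSpace (HomotopyFiber f t) := by
  refine simply_connected_iff_paths_homotopic'.2 ⟨hf.pathConnectedSpace_fiber t, ?_⟩
  intro x y p q
  obtain ⟨R, ⟨HR⟩, hR⟩ := exists_delay f t
  refine homotopic_of_map_homotopic_id HR ?_
  -- Bounding the radius below by `1 / 2` keeps the radial projection continuous at the origin. The
  -- inner square goes to `t`, matching the constant last quarter of the delayed paths.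
  let m : ℝ × ℝ → ℝ := fun z => max ‖z‖ (1 / 2)
  have hm : ∀ z, 0 < m z := fun z => lt_max_of_lt_right (by norm_num)
  have hmc : Continuous m := by fun_prop
  let P : Path x y → ℝ × ℝ → T := fun p z =>
    (p (uncentered (z.1 / m z))).1.2 (clamp (2 - 2 * m z))
  have hP : ∀ p, Continuous (P p) := fun p => continuous_fiber_path.comp
    ((p.continuous.comp (continuous_uncentered.comp
      (continuous_fst.div hmc fun z => (hm z).ne'))).prodMk (continuous_clamp.comp (by fun_prop)))
  let ψ : ℝ × ℝ → T := fun z => if z.2 ≤ 0 then P p z else P q z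
  have hPt : ∀ p z, ‖z‖ ≤ 1 / 2 → P p z = t := fun p z hz => by
    have : m z = 1 / 2 := max_eq_right hz
    simp only [P]
    rw [this, clamp_of_one_le (by norm_num)]
    exact (p _).2.2
  have hside : ∀ z : ℝ × ℝ, ‖z‖ = |z.1| → P p z = P q z := by
    intro z hz
    rcases le_total ‖z‖ (1 / 2) with h | h
    · rw [hPt p z h, hPt q z h]
    · have hmz : m z = |z.1| := (max_eq_left h).trans hz
      have hne : |z.1| ≠ 0 := by
        rw [← hz]
        linarith
      simp only [P]
      rw [hmz]
      rcases abs_choice z.1 with h1 | h1 <;> rw [h1] at hne ⊢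
      · rw [div_self hne, uncentered_one, p.target, q.target]
      · rw [div_neg, div_self (neg_ne_zero.1 hne), uncentered_neg_one, p.source, q.source]
  have hψ : Continuous ψ := by
    refine Continuous.if_le (hP p) (hP q) continuous_snd continuous_const fun z hz => hside z ?_
    rw [Prod.norm_def, hz, norm_zero]
    exact max_eq_left (norm_nonneg _)
  have hPray : ∀ (p : Path x y) (z : ℝ × ℝ), ‖z‖ = 1 → ∀ a : unitInterval,
      P p (min 1 (2 - 2 * (a : ℝ)) • z) = (R (p (uncentered z.1))).1.2 a := by
    intro p z hz a
    have ha := a.2.2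
    rw [(hR _).2]
    have hmin : 0 ≤ min 1 (2 - 2 * (a : ℝ)) := le_min zero_le_one (by linarith)
    set c := min 1 (2 - 2 * (a : ℝ))
    have hcn : ‖c • z‖ = c := by rw [norm_smul, hz, mul_one, Real.norm_of_nonneg hmin]
    rcases le_total c (1 / 2) with h | h
    · rw [hPt _ _ (hcn.trans_le h), clamp_of_one_le, (p _).2.2]
      rcases min_choice 1 (2 - 2 * (a : ℝ)) with h' | h' <;> simp only [c, h'] at h <;> linarith
    · have hmc : m (c • z) = c := (congrArg (max · (1 / 2)) hcn).trans (max_eq_left h)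
      have hclamp : clamp (2 - 2 * c) = clamp (4 * a - 2) := by
        rcases le_total (a : ℝ) (1 / 2) with h' | h'
        · rw [clamp_of_le_zero (a := 4 * (a : ℝ) - 2) (by linarith)]
          simp only [c]
          rw [min_eq_left (by linarith), clamp_of_le_zero (by norm_num)]
        · simp only [c]
          rw [min_eq_right (by linarith)]
          ring_nf
      simp only [P]
      rw [hmc, hclamp, Prod.smul_fst, smul_eq_mul, mul_div_cancel_left₀]
      linarith
  have hψray : ∀ z : ℝ × ℝ, ‖z‖ = 1 → ∀ a : unitInterval,
      ψ (min 1 (2 - 2 * (a : ℝ)) • z) =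
        (R (if z.2 ≤ 0 then p (uncentered z.1) else q (uncentered z.1))).1.2 a := by
    intro z hz a
    have ha := a.2.2
    have hmin : 0 ≤ min 1 (2 - 2 * (a : ℝ)) := le_min zero_le_one (by linarith)
    have e : (R (if z.2 ≤ 0 then p (uncentered z.1) else q (uncentered z.1))).1.2 a =
        if z.2 ≤ 0 then P p (min 1 (2 - 2 * (a : ℝ)) • z)
        else P q (min 1 (2 - 2 * (a : ℝ)) • z) := by
      split_ifs
      · exact (hPray p z hz a).symm
      · exact (hPray q z hz a).symm
    rw [e]
    -- At the center the sign of `z.2` is lost, but both branches take the value `t` there.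
    rcases eq_or_lt_of_le hmin with h0 | h0
    · simp only [ψ, ← h0, zero_smul]
      rw [hPt _ _ (by simp), hPt _ _ (by simp)]
      simp
    · simp only [ψ, Prod.smul_snd, smul_eq_mul, mul_nonpos_iff_pos_imp_nonpos, h0]
      simp [h0.le]
  have hψ1 : ∀ z : ℝ × ℝ, ‖z‖ = 1 →
      ψ z = f (if z.2 ≤ 0 then p (uncentered z.1) else q (uncentered z.1)).1.1 := by
    intro z hz
    have := hψray z hz 0
    rw [Set.Icc.coe_zero, mul_zero, sub_zero, min_eq_left one_le_two, one_smul] at this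
    rw [this, (R _).2.1, (hR _).1]
  obtain ⟨G, hG⟩ := hf.exists_fiber_extension (t := t) hf.hasFreeCompression.hasCompression hψ
    (fun z hz => ⟨_, (hψ1 z hz).symm⟩) (by
      simp only [ψ]
      rw [if_pos (by simp), hPt _ _ (by simp)])
  have hGR : ∀ z : Metric.closedBall (0 : ℝ × ℝ) 1, ‖z.1‖ = 1 →
      G z = R (if z.1.2 ≤ 0 then p (uncentered z.1.1) else q (uncentered z.1.1)) := fun z hz =>
    HomotopyFiber.ext (hf.injective (((hG z hz).1.trans (hψ1 _ hz)).trans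
      (congrArg f (hR _).1.symm))) fun a => ((hG z hz).2 a).trans (hψray _ hz a)
  -- Coordinates are swapped: homotopy time is the vertical coordinate, from the edge of `p` to that
  -- of `q`.
  let k : unitInterval × unitInterval → Metric.closedBall (0 : ℝ × ℝ) 1 := fun z =>
    ⟨(centered z.2, centered z.1), mem_closedBall_zero_iff.2 (norm_pair_centered_le _ _)⟩
  have hk : Continuous k := ((continuous_centered.comp continuous_snd).prodMk
    (continuous_centered.comp continuous_fst)).subtype_mk _
  have hGk : ∀ a b : unitInterval, (b = 0 ∨ b = 1) ∨ a = 0 ∨ a = 1 →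
      G (k (a, b)) = R (if centered a ≤ 0 then p b else q b) := fun a b hab => by
    rw [hGR _ (norm_pair_centered_eq_one hab)]
    simp only [k, uncentered_centered]
  refine ⟨⟨⟨⟨fun z => G (k z), G.continuous.comp hk⟩, fun b => ?_, fun b => ?_⟩,
    fun a b hb => (hGk a b (Or.inl hb)).trans (congrArg R ?_)⟩⟩
  · refine (hGk 0 b (by simp)).trans ?_
    rw [centered_zero, if_pos (by norm_num)]
    rfl
  · refine (hGk 1 b (by simp)).trans ?_
    rw [centered_one, if_neg (by norm_num)]
    rfl
  · rcases hb with rfl | rfl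
    · rw [p.source, q.source, ite_self]
    · rw [p.target, q.target, ite_self]

end IsSquareCompressible

end Fiber

/-! ### Application to the Vietoris-Rips inclusion. -/

section Rips

variable {Z : Type u} [PseudoEMetricSpace Z] {X Y : Set Z} {r : ℝ≥0}

theorem isSquareCompressible_ripsInclusion (hfin : (X ∩ Y).Finite) (hg : IsMetricGluing X Y)
    (hs : StrongSimplexAssumption X Y r) : IsSquareCompressible (ripsInclusion X Y r) where
  injective := realizationInclusion_injective _
  continuous_of_comp := continuous_of_continuous_inclusion _
  hasFreeCompression := by
    have : Set.range (ripsInclusion X Y r) = ripsRange X Y r := by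
      ext p
      constructor
      · rintro ⟨q, rfl⟩
        exact q.2.1
      · exact fun hp => ⟨⟨p.1, hp, p.2.2⟩, rfl⟩
    rw [this]
    exact hasFreeCompression_ripsRange hfin hg hs

end Rips

end SimplicialGluing

theorem mainTheorem3 {Z : Type*} [PseudoEMetricSpace Z] (X Y : Set Z)
    (hfin : (X ∩ Y).Finite) (hglue : SimplicialGluing.IsMetricGluing X Y)
    (r : ℝ≥0) (hsimplex : SimplicialGluing.StrongSimplexAssumption X Y r) :
    (∀ σ ∈ SimplicialGluing.vietorisRips (Set.univ : Set Z) r,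
      σ ∉ SimplicialGluing.decompositionPoset
        (SimplicialGluing.vietorisRips (Set.univ : Set Z) r) X Y →
      (((σ : Set Z) ∩ X).ncard = 1 ∨ ((σ : Set Z) ∩ Y).ncard = 1) →
      ContractibleSpace (SimplicialGluing.Realization
        (SimplicialGluing.obstructionComplex
          (SimplicialGluing.vietorisRips (Set.univ : Set Z) r) σ (X ∩ Y)))) ∧
    (∀ z : SimplicialGluing.Realization (SimplicialGluing.vietorisRips (Set.univ : Set Z) r),
      SimplyConnectedSpace
        (SimplicialGluing.HomotopyFiber (SimplicialGluing.ripsInclusion X Y r) z)) ∧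
    Function.Bijective (SimplicialGluing.piZeroMap (SimplicialGluing.ripsInclusion X Y r)) ∧
    (∀ w : SimplicialGluing.Realization
        (SimplicialGluing.vietorisRips X r ⊔ SimplicialGluing.vietorisRips Y r),
      Function.Bijective (FundamentalGroup.map (SimplicialGluing.ripsInclusion X Y r) w) ∧
      Function.Surjective
        (SimplicialGluing.homotopyGroupMap (Fin 2) (SimplicialGluing.ripsInclusion X Y r) w)) := by
  have hf := SimplicialGluing.isSquareCompressible_ripsInclusion hfin hglue hsimplex
  exact ⟨fun σ hσ hP h1 =>
      SimplicialGluing.contractibleSpace_obstructionComplex hfin hglue hsimplex ⟨hσ, hP⟩ h1,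
    hf.simplyConnectedSpace_fiber, hf.bijective_piZeroMap,
    fun w => ⟨hf.bijective_fundamentalGroup_map w, hf.surjective_homotopyGroupMap_two w⟩⟩
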